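/- Let $R_0>0$ and let $V\in L^\infty(\mathbb R^3;\mathbb C)$ with $\operatorname{supp}V\subset B(0,R_0)$. For $\lambda\in\mathbb C$ and $f\in L^2_{\rm comp}(\mathbb R^3)$ put $$R_0(\lambda)f(x)=\int_{\mathbb R^3}\frac{e^{i\lambda|x-y|}}{4\pi|x-y|}f(y)\,dy ,\qquad R_V(\lambda)=R_0(\lambda)\,(I+VR_0(\lambda))^{-1}:L^2_{\rm comp}(\mathbb R^3)\to L^2_{\rm loc}(\mathbb R^3),$$ at all $\lambda$ at which $I+VR_0(\lambda):L^2_{\rm comp}\to L^2_{\rm comp}$ is bijective. For $\Im\lambda$ sufficiently large this inverse exists and $R_V(\lambda)=(P_V-\lambda^2)^{-1}$ on $L^2_{\rm comp}$, where $P_V=-\Delta+V$ on $L^2(\mathbb R^3)$: for every $f\in L^2_{\rm comp}$, $u=R_V(\lambda)f$ is the unique $u\in L^2(\mathbb R^3)$ with $(-\Delta+V-\lambda^2)u=f$ in the sense of distributions. The scattering resonances of $V$ are the poles of the meromorphic family $\lambda\mapsto R_V(\lambda)$, that is, the points $\mu\in\mathbb C$ across which it is not holomorphic (a family being holomorphic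 across $\mu$ if it is defined in a punctured neighbourhood of $\mu$ and, for every $\chi\in C_c^\infty(\mathbb R^3)$, $\chi R_V(\lambda)\chi$ coincides there with a family of bounded operators on $L^2(\mathbb R^3)$ which is holomorphic at $\mu$). There is $A>0$ such that in the region $$\Omega_A=\Big\{\lambda\in\mathbb C:\ \Im\lambda>-\frac1{2R_0}\log|\Re\lambda|+A\Big\}$$ (with $-\log 0=+\infty$) the operator $R_V(\lambda)$ is defined and $V$ has no scattering resonances, and such that for every $R_1\ge R_0$ and every $\chi\in C_c^\infty(B(0,R_1))$ there is a constant $C$ with $$\|\chi R_V(\lambda)\chi\|_{L^2\to H^j}\le C\,(1+|\lambda|)^{j-1}e^{2R_1(\Im\lambda)_-},\qquad j=0,1,\quad \lambda\in\Omega_A ,$$ where $(t)_-=\max(-t,0)$. -/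

import Mathlib

open MeasureTheory Filter Topology
open scoped ENNReal ContDiff Laplacian

noncomputable section

namespace Scattering

/-- Three dimensional Euclidean space. -/
abbrev E3 : Type := EuclideanSpace ℝ (Fin 3)

/-- `L²(ℝ³)` with complex values. -/
abbrev L2 : Type := Lp ℂ 2 (volume : Measure E3)

/-- `f` represents an element of `L²_comp(ℝ³)`: it is in `L²` and it vanishes almost everywhere
outside some ball. -/
def IsL2Comp (f : E3 → ℂ) : Prop :=
  MemLp f 2 volume ∧ ∃ r : ℝ, ∀ᵐ x : E3, r < ‖x‖ → f x = 0

/-- `χ ∈ C_c^∞(ℝ³)`, complex valued. -/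
def IsTest (χ : E3 → ℂ) : Prop := ContDiff ℝ ∞ χ ∧ HasCompactSupport χ

/-- The kernel `exp(iλ|x-y|) / (4π|x-y|)` of the free resolvent. -/
def freeKernel (lam : ℂ) (x y : E3) : ℂ :=
  Complex.exp (Complex.I * lam * (‖x - y‖ : ℂ)) / (4 * (Real.pi : ℂ) * (‖x - y‖ : ℂ))

/-- The free resolvent `R₀(λ)`, `λ ∈ ℂ`, acting on `L²_comp(ℝ³)`. (For `f` in `L²_comp` the
integral converges absolutely for every `x`.) -/
def freeResolvent (lam : ℂ) (f : E3 → ℂ) : E3 → ℂ :=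
  fun x => ∫ y, freeKernel lam x y * f y

/-- `g ∈ L²_comp` solves `(I + V R₀(λ)) g = f`. -/
def SolvesIVR (V : E3 → ℂ) (lam : ℂ) (f g : E3 → ℂ) : Prop :=
  IsL2Comp g ∧ ∀ᵐ x : E3, g x + V x * freeResolvent lam g x = f x

/-- `I + V R₀(λ) : L²_comp → L²_comp` is invertible (bijective, functions being identified when
they agree almost everywhere). -/
def IVRInvertible (V : E3 → ℂ) (lam : ℂ) : Prop :=
  ∀ f : E3 → ℂ, IsL2Comp f →
    ∃ g : E3 → ℂ, SolvesIVR V lam f g ∧ ∀ g' : E3 → ℂ, SolvesIVR V lam f g' → g' =ᵐ[volume] g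

open Classical in
/-- The operator `(I + V R₀(λ))⁻¹` on `L²_comp`; meaningful where `IVRInvertible V lam` holds. -/
def ivrInverse (V : E3 → ℂ) (lam : ℂ) (f : E3 → ℂ) : E3 → ℂ :=
  if h : ∃ g : E3 → ℂ, SolvesIVR V lam f g then h.choose else 0

/-- The scattering resolvent `R_V(λ) = R₀(λ) (I + V R₀(λ))⁻¹ : L²_comp → L²_loc`, at the points
`λ ∈ ℂ` at which `IVRInvertible V lam` holds. -/
def scatteringResolvent (V : E3 → ℂ) (lam : ℂ) (f : E3 → ℂ) : E3 → ℂ :=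
  freeResolvent lam (ivrInverse V lam f)

/-- The cut-off resolvent `χ R_V(λ) χ`. -/
def cutoffResolvent (V : E3 → ℂ) (χ : E3 → ℂ) (lam : ℂ) (f : E3 → ℂ) : E3 → ℂ :=
  fun x => χ x * scatteringResolvent V lam (fun y => χ y * f y) x

/-- The family `R_V : L²_comp → L²_loc` is defined near `μ`, except possibly at `μ`, and is
holomorphic across `μ`: for each cut-off `χ` the family `χ R_V(λ) χ` coincides, for `λ ≠ μ` near
`μ`, with a family of bounded operators on `L²` which is holomorphic (in operator norm) at `μ`. -/
def IsHolomorphicAcross (V : E3 → ℂ) (μ : ℂ) : Prop :=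
  (∀ᶠ lam in 𝓝[≠] μ, IVRInvertible V lam) ∧
  ∀ χ : E3 → ℂ, IsTest χ →
    ∃ T : ℂ → (L2 →L[ℂ] L2), AnalyticAt ℂ T μ ∧
      ∀ᶠ lam in 𝓝[≠] μ, ∀ f : L2, (T lam f : E3 → ℂ) =ᵐ[volume] cutoffResolvent V χ lam f

/-- A scattering resonance of `V`: a singularity of `λ ↦ R_V(λ)`. As `R_V` is a meromorphic
family, the singularities are exactly the poles. -/
def IsResonance (V : E3 → ℂ) (μ : ℂ) : Prop := ¬ IsHolomorphicAcross V μ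

/-- `u` is an element of the domain `{u ∈ L² : Δ u ∈ L²} = H²(ℝ³)` of `P_V = -Δ + V` with
`(P_V - λ²) u = f`, derivatives being taken in the sense of distributions
(`V` bounded, `f ∈ L²`). -/
def SolvesSchrodinger (V : E3 → ℂ) (lam : ℂ) (f u : E3 → ℂ) : Prop :=
  MemLp u 2 volume ∧
  ∀ φ : E3 → ℂ, IsTest φ →
    ∫ x, (u x * (-(Δ φ) x) + (V x - lam ^ 2) * u x * φ x) = ∫ x, f x * φ x

/-- `v` is the weak partial derivative `∂u/∂x_k`. -/
def HasWeakPartial (k : Fin 3) (u v : E3 → ℂ) : Prop :=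
  ∀ φ : E3 → ℂ, IsTest φ →
    ∫ x, u x * fderiv ℝ φ x (EuclideanSpace.single k (1 : ℝ)) = -∫ x, v x * φ x

/-- The norm of the Sobolev space `H^j(ℝ³)`, with value `∞` on functions that are not in `H^j`:
`‖u‖_{H^0} = ‖u‖_{L²}` and `‖u‖_{H^{j+1}}² = ‖u‖_{L²}² + ∑_k ‖∂_k u‖_{H^j}²`. -/
def sobolevNorm : ℕ → (E3 → ℂ) → ℝ≥0∞
  | 0, u => ⨅ _ : AEStronglyMeasurable u volume, eLpNorm u 2 volume
  | j + 1, u => ⨅ (v : Fin 3 → E3 → ℂ) (_ : ∀ k, HasWeakPartial k u (v k)),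
      (sobolevNorm 0 u ^ 2 + ∑ k, sobolevNorm j (v k) ^ 2) ^ (1 / 2 : ℝ)

/-- The region `Im λ > -(1/(2R₀)) log|Re λ| + A` (empty on the imaginary axis, where
`-log|Re λ| = +∞`). -/
def logRegion (R₀ A : ℝ) : Set ℂ :=
  {lam | lam.re ≠ 0 ∧ -(1 / (2 * R₀)) * Real.log |lam.re| + A < lam.im}

end Scattering

end

/-! The proof is perturbative: `V R₀(λ)` is small in the logarithmic region, so `I + V R₀(λ)` is
inverted by a Neumann series.

If the data live in a ball of radius `r` and the result is observed in a ball of radius `ρ`, only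
`|x - y| ≤ r + ρ` matters, and the kernel of `R₀(λ)` may be cut off at any `T ≥ r + ρ`. The
truncated kernel is integrable and radial. Convolution with it is the Fourier multiplier with symbol
`∫₀ᵀ e^{iλr} sin(κr)/κ dr`, `κ = 2π|ξ|`. One integration by parts bounds the symbol by `2T e^{T(Im
λ)₋}/|λ|` (`norm_symb_le`), while `κ` times the symbol is at most `T e^{T(Im λ)₋}`
(`norm_mul_symb_le`). These are the `L² → L²` and `L² → H¹` bounds. The symbol is also entire in `λ`
with values in `L^∞`.

On the ball of radius `R₀` one takes `T = 2R₀`, so `V R₀(λ)` is `O(e^{2R₀(Im λ)₋}/|λ|)`. The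
logarithmic region with `A` large makes `e^{2R₀(Im λ)₋}/|λ|` as small as desired
(`exp_le_mul_norm_of_mem_logRegion`). For general compactly supported data the solution is `g = f -
h`, where `h + V R₀(λ) h = V R₀(λ) f`. This `h` lives in the ball of radius `R₀`, so inverting there
suffices (`solvesIVR_sub_corrOp`, `solvesIVR_unique`).

In `χ R_V χ` the correction crosses from radius `R₁` to `R₀` and back, which costs `e^{2(R₀+R₁)(Im
λ)₋}/|λ|²`. The region absorbs `e^{2R₀(Im λ)₋}/|λ|` and leaves the claimed bound (`norm_resOp_le`,
`norm_gradResOp_le`).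

For `Im λ > 0` the full kernel is integrable with symbol `1/(κ² - λ²)`, which identifies `R_V(λ)`
with the `L²` resolvent. -/

noncomputable section

namespace Scattering

open FourierTransform LineDeriv
open scoped SchwartzMap

/-! ### Multiplication operators and Fourier multipliers on `L²`. -/

/-- Multiplication of `L²` functions by essentially bounded functions. -/
def mulL : Lp ℂ ∞ (volume : Measure E3) →L[ℂ] L2 →L[ℂ] L2 :=
  (ContinuousLinearMap.mul ℂ ℂ).holderL volume ∞ 2 2

lemma coeFn_mulL (m : Lp ℂ ∞ (volume : Measure E3)) (f : L2) :
    mulL m f =ᵐ[volume] fun x => m x * f x := by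
  simpa [mulL] using (ContinuousLinearMap.mul ℂ ℂ).coeFn_holder (r := 2) m f

lemma norm_mulL_le (m : Lp ℂ ∞ (volume : Measure E3)) : ‖mulL m‖ ≤ ‖m‖ := by
  refine ContinuousLinearMap.opNorm_le_bound _ (norm_nonneg _) fun f => ?_
  have h := (ContinuousLinearMap.mul ℂ ℂ).norm_holder_apply_apply_le (r := 2) m f
  have h1 := ContinuousLinearMap.opNorm_mul_le ℂ ℂ
  calc _ ≤ _ := h
    _ ≤ 1 * ‖m‖ * ‖f‖ := by gcongr
    _ = _ := by ring

/-- The Fourier multiplier operator on `L²` with an essentially bounded symbol. -/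
def fourierMult : Lp ℂ ∞ (volume : Measure E3) →L[ℂ] L2 →L[ℂ] L2 :=
  (ContinuousLinearMap.compL ℂ L2 L2 L2 (fourierInvCLM ℂ L2)) ∘L
    ((ContinuousLinearMap.compL ℂ L2 L2 L2).flip (fourierCLM ℂ L2)) ∘L mulL

lemma fourierMult_apply (m : Lp ℂ ∞ (volume : Measure E3)) (f : L2) :
    fourierMult m f = 𝓕⁻ (mulL m (𝓕 f)) := rfl

lemma fourier_fourierMult (m : Lp ℂ ∞ (volume : Measure E3)) (f : L2) :
    𝓕 (fourierMult m f) = mulL m (𝓕 f) := by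
  rw [fourierMult_apply, fourier_fourierInv_eq]

lemma norm_fourierMult_le (m : Lp ℂ ∞ (volume : Measure E3)) : ‖fourierMult m‖ ≤ ‖m‖ := by
  refine ContinuousLinearMap.opNorm_le_bound _ (norm_nonneg _) fun f => ?_
  rw [← Lp.norm_fourier_eq, fourier_fourierMult]
  refine ((mulL m).le_opNorm _).trans ?_
  rw [Lp.norm_fourier_eq]
  gcongr
  exact norm_mulL_le m

/-- The class in `L^∞` of a bounded measurable function (`0` if it is not one). -/
def bddClass (m : E3 → ℂ) : Lp ℂ ∞ (volume : Measure E3) := by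
  classical exact if h : MemLp m ∞ volume then h.toLp m else 0

lemma coeFn_bddClass {m : E3 → ℂ} (h : MemLp m ∞ volume) : bddClass m =ᵐ[volume] m := by
  rw [bddClass, dif_pos h]; exact h.coeFn_toLp

lemma norm_bddClass_le {m : E3 → ℂ} {C : ℝ} (hC : 0 ≤ C) (hm : ∀ x, ‖m x‖ ≤ C) :
    ‖bddClass m‖ ≤ C := by
  rw [bddClass]
  split_ifs with h
  · rw [Lp.norm_toLp, eLpNorm_exponent_top]
    refine ENNReal.toReal_le_of_le_ofReal hC ?_
    refine eLpNormEssSup_le_of_ae_bound (ae_of_all _ hm)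
  · simpa using hC

lemma memLp_top_of_bdd {m : E3 → ℂ} (h : Measurable m) {C : ℝ} (hm : ∀ x, ‖m x‖ ≤ C) :
    MemLp m ∞ volume :=
  memLp_top_of_bound h.aestronglyMeasurable C (ae_of_all _ hm)

/-- The distributional definition of `𝓕 f`, tested on `𝓕⁻ φ`. All weak identities below are moved to
the Fourier side, and so reduced to identities between symbols, by this pairing. -/
lemma integral_mul_eq_integral_fourier (f : L2) (φ : 𝓢(E3, ℂ)) :
    ∫ x, f x * φ x = ∫ ξ, (𝓕 f : L2) ξ * (𝓕⁻ φ) ξ := by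
  have h := congrArg (fun T => T (𝓕⁻ φ)) (Lp.fourier_toTemperedDistribution_eq f)
  simp only [TemperedDistribution.fourier_apply, fourier_fourierInv_eq,
    Lp.toTemperedDistribution_apply, smul_eq_mul] at h
  simpa only [mul_comm] using h

lemma integral_fourierMult_mul (m : Lp ℂ ∞ (volume : Measure E3)) (f : L2) (φ : 𝓢(E3, ℂ)) :
    ∫ x, fourierMult m f x * φ x = ∫ ξ, m ξ * (𝓕 f : L2) ξ * (𝓕⁻ φ) ξ := by
  rw [integral_mul_eq_integral_fourier, fourier_fourierMult]
  refine integral_congr_ae ?_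
  filter_upwards [coeFn_mulL m (𝓕 f)] with x hx
  rw [hx]

lemma integral_mul_fourier_eq {f : E3 → ℂ} (hf : Integrable f) (φ : 𝓢(E3, ℂ)) :
    ∫ x, f x * (𝓕 φ) x = ∫ ξ, 𝓕 f ξ * φ ξ := by
  have := VectorFourier.integral_fourierIntegral_smul_eq_flip (L := innerₗ E3) (f := f)
    (g := φ) Real.continuous_fourierChar continuous_inner hf (φ.integrable (μ := volume))
  simp only [smul_eq_mul, flip_innerₗ] at this
  exact this.symm

lemma locallyIntegrable_ae_eq_zero {f : E3 → ℂ} (hf : LocallyIntegrable f)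
    (h : ∀ φ : 𝓢(E3, ℂ), ∫ x, f x * φ x = 0) : f =ᵐ[volume] 0 := by
  refine ae_eq_zero_of_integral_contDiff_smul_eq_zero hf fun g hg hc => ?_
  have hg₁ : HasCompactSupport (Complex.ofRealCLM ∘ g) := hc.comp_left rfl
  have hg₂ : ContDiff ℝ ∞ (Complex.ofRealCLM ∘ g) := by fun_prop
  simpa [mul_comm] using h (hg₁.toSchwartzMap hg₂)

lemma ae_eq_of_sub_ae_eq_zero {f g : E3 → ℂ} (h : f - g =ᵐ[volume] 0) : f =ᵐ[volume] g := by
  filter_upwards [h] with x hx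
  exact sub_eq_zero.mp hx

/-- The `L²` transform and the Fourier integral have the same pairing with every Schwartz function,
and both are locally integrable. -/
lemma fourier_toLp_ae_eq {f : E3 → ℂ} (h1 : Integrable f) (h2 : MemLp f 2 volume) :
    (𝓕 (h2.toLp f) : L2) =ᵐ[volume] 𝓕 f := by
  have hc : Continuous (𝓕 f) := VectorFourier.fourierIntegral_continuous
    Real.continuous_fourierChar (L := innerₗ E3) continuous_inner h1
  have hl : LocallyIntegrable (𝓕 (h2.toLp f) : L2) volume :=
    (Lp.memLp _).locallyIntegrable one_le_two
  refine ae_eq_of_sub_ae_eq_zero ?_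
  refine locallyIntegrable_ae_eq_zero (hl.sub hc.locallyIntegrable) fun φ => ?_
  have e1 : ∫ x, (𝓕 (h2.toLp f) : L2) x * φ x = ∫ x, f x * (𝓕 φ) x := by
    have := integral_mul_eq_integral_fourier (h2.toLp f) (𝓕 φ)
    rw [fourierInv_fourier_eq] at this
    rw [← this]
    refine integral_congr_ae ?_
    filter_upwards [h2.coeFn_toLp] with x hx
    rw [hx]
  have e2 := integral_mul_fourier_eq h1 φ
  have i1 : Integrable (fun x => (𝓕 (h2.toLp f) : L2) x * φ x) :=
    (Lp.memLp _).integrable_mul (φ.memLp 2)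
  have i2 : Integrable (fun x => 𝓕 f x * φ x) := by
    refine φ.integrable.bdd_mul hc.aestronglyMeasurable (c := ∫ x, ‖f x‖) (ae_of_all _ fun x => ?_)
    exact VectorFourier.norm_fourierIntegral_le_integral_norm _ _ _ _ _
  simp only [Pi.sub_apply, sub_mul]
  rw [integral_sub i1 i2, e1, e2, sub_self]

lemma IsL2Comp.integrable {f : E3 → ℂ} (hf : IsL2Comp f) : Integrable f := by
  obtain ⟨h, r, hr⟩ := hf
  have : IntegrableOn f (Metric.closedBall 0 r) := by
    have : IsFiniteMeasure (volume.restrict (Metric.closedBall (0 : E3) r)) :=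
      ⟨by simpa using (isCompact_closedBall (0 : E3) r).measure_lt_top (μ := volume)⟩
    exact (h.restrict _).integrable one_le_two
  rw [← integrable_indicator_iff measurableSet_closedBall] at this
  refine this.congr ?_
  filter_upwards [hr] with x hx
  by_cases hxr : ‖x‖ ≤ r
  · simp [hxr]
  · simp [hxr, hx (not_le.mp hxr)]

/-- The convolution with an integrable function is a Fourier multiplier. -/
lemma fourierMult_ae_eq_convolution {k : E3 → ℂ} (hk : Integrable k)
    {m : Lp ℂ ∞ (volume : Measure E3)} (hm : m =ᵐ[volume] 𝓕 k) {f : E3 → ℂ} (hf : IsL2Comp f) :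
    fourierMult m (hf.1.toLp f) =ᵐ[volume] fun x => ∫ y, k (x - y) * f y := by
  have h1 := hf.integrable
  set F : E3 → ℂ := fun x => ∫ y, k (x - y) * f y with hF
  have hFc : F = convolution f k (ContinuousLinearMap.mul ℂ ℂ) volume := by
    funext x; simp only [hF, convolution, ContinuousLinearMap.mul_apply', mul_comm]
  have hFi : Integrable F := by
    rw [hFc]; exact h1.integrable_convolution _ hk
  have hFt (ξ : E3) : 𝓕 F ξ = 𝓕 f ξ * 𝓕 k ξ := by
    rw [hFc]; exact Real.fourier_mul_convolution_eq h1 hk ξ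
  have hl : LocallyIntegrable (fourierMult m (hf.1.toLp f)) volume :=
    (Lp.memLp _).locallyIntegrable one_le_two
  -- Both sides are compared as distributions: the convolution is in `L¹`, so its Fourier integral
  -- is available, and `φ` is written as `𝓕 (𝓕⁻ φ)`.
  refine ae_eq_of_sub_ae_eq_zero ?_
  refine locallyIntegrable_ae_eq_zero (hl.sub hFi.locallyIntegrable) fun φ => ?_
  have i1 : Integrable (fun x => fourierMult m (hf.1.toLp f) x * φ x) :=
    (Lp.memLp _).integrable_mul (φ.memLp 2)
  have i2 : Integrable (fun x => F x * φ x) :=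
    hFi.mul_bdd (φ.memLp_top.1) (c := SchwartzMap.seminorm ℝ 0 0 φ)
      (ae_of_all _ (φ.norm_le_seminorm ℝ))
  have e2 := integral_mul_fourier_eq hFi (𝓕⁻ φ)
  rw [fourier_fourierInv_eq] at e2
  simp only [Pi.sub_apply, sub_mul]
  rw [integral_sub i1 i2, integral_fourierMult_mul, e2, sub_eq_zero]
  refine integral_congr_ae ?_
  filter_upwards [hm, fourier_toLp_ae_eq h1 hf.1] with x hx hx'
  rw [hx, hx', hFt, mul_comm (𝓕 k x)]

lemma fourierInv_lineDeriv (φ : 𝓢(E3, ℂ)) (v ξ : E3) :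
    (𝓕⁻ (∂_{v} φ)) ξ = -(2 * Real.pi * Complex.I) * (inner ℝ ξ v : ℝ) * (𝓕⁻ φ) ξ := by
  have : (inner ℝ · v : E3 → ℝ).HasTemperateGrowth := by fun_prop
  rw [SchwartzMap.fourierInv_lineDerivOp_eq]
  simp [SchwartzMap.smulLeftCLM_apply_apply this, mul_assoc]

lemma fourierInv_laplacian (φ : 𝓢(E3, ℂ)) (ξ : E3) :
    (𝓕⁻ (Δ φ)) ξ = -((2 * Real.pi * ‖ξ‖ : ℝ) : ℂ) ^ 2 * (𝓕⁻ φ) ξ := by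
  have h : 𝓕⁻ (Δ φ) = ∑ i, 𝓕⁻ (∂_{stdOrthonormalBasis ℝ E3 i} (∂_{stdOrthonormalBasis ℝ E3 i} φ)) := by
    rw [SchwartzMap.laplacian_eq_sum (stdOrthonormalBasis ℝ E3)]
    exact map_sum (fourierInvCLM ℂ 𝓢(E3, ℂ)) _ _
  have h2 : (‖ξ‖ : ℂ) ^ 2 = ∑ i, ((inner ℝ ξ (stdOrthonormalBasis ℝ E3 i) : ℝ) : ℂ) ^ 2 := by
    exact_mod_cast ((stdOrthonormalBasis ℝ E3).sum_sq_inner_left ξ).symm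
  rw [h, sum_apply]
  simp only [fourierInv_lineDeriv]
  push_cast
  rw [mul_pow, h2, Finset.mul_sum, ← Finset.sum_neg_distrib, Finset.sum_mul]
  refine Finset.sum_congr rfl fun i _ => ?_
  have := Complex.I_sq
  linear_combination (4 * (Real.pi : ℂ)^2 * ((inner ℝ ξ (stdOrthonormalBasis ℝ E3 i) : ℝ) : ℂ) ^ 2 * (𝓕⁻ φ) ξ) * this

end Scattering
end

/-! ### The Fourier transform of radial functions on `ℝ³`. -/

noncomputable section

namespace Scattering

open FourierTransform Set

/-- Every vector can be rotated onto the first axis of `ℝ × ℝ²`. -/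
lemma exists_isometry_axis (ξ : E3) :
    ∃ e : E3 ≃ₗᵢ[ℝ] WithLp 2 (ℝ × EuclideanSpace ℝ (Fin 2)), e ξ = WithLp.toLp 2 (‖ξ‖, 0) := by
  have hd : Module.finrank ℝ (WithLp 2 (ℝ × EuclideanSpace ℝ (Fin 2))) = 3 := by
    rw [(WithLp.linearEquiv 2 ℝ (ℝ × EuclideanSpace ℝ (Fin 2))).finrank_eq]
    simp
  let e₀ : E3 ≃ₗᵢ[ℝ] WithLp 2 (ℝ × EuclideanSpace ℝ (Fin 2)) :=
    (stdOrthonormalBasis ℝ E3).equiv (stdOrthonormalBasis ℝ _)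
      (finCongr (by rw [hd]; simp))
  have hn : ‖e₀ ξ‖ = ‖WithLp.toLp 2 ((‖ξ‖, 0) : ℝ × EuclideanSpace ℝ (Fin 2))‖ := by
    rw [e₀.norm_map, WithLp.prod_norm_eq_of_L2]
    simp
  -- Two vectors of equal norm are exchanged by the reflection in the hyperplane orthogonal to their
  -- difference.
  exact ⟨e₀.trans (Submodule.reflection _), Submodule.reflection_sub hn⟩

/-- Polar coordinates in the plane, followed by the substitution `s = √(x² + r²)`, for which `s ds =
r dr`. -/
lemma integral_radial_plane (x : ℝ) (F : ℝ → ℂ) :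
    ∫ w : EuclideanSpace ℝ (Fin 2), F (√(x ^ 2 + ‖w‖ ^ 2)) =
      (2 * Real.pi) • ∫ s in Ioi |x|, s • F s := by
  have hr : (volume : Measure (EuclideanSpace ℝ (Fin 2))).real (Metric.ball 0 1) = Real.pi := by
    simp [Measure.real, EuclideanSpace.volume_ball_fin_two, Real.pi_pos.le]
  rw [integral_fun_norm_addHaar volume (fun r => F (√(x ^ 2 + r ^ 2))), hr]
  have himg : (fun r : ℝ => √(x ^ 2 + r ^ 2)) '' Ioi 0 = Ioi |x| := by
    ext s
    constructor
    · rintro ⟨r, hr : 0 < r, rfl⟩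
      exact Real.lt_sqrt_of_sq_lt (by rw [sq_abs]; nlinarith)
    · intro (hs : |x| < s)
      have hs2 : x ^ 2 < s ^ 2 := by
        rw [← sq_abs x]; exact pow_lt_pow_left₀ hs (abs_nonneg x) two_ne_zero
      have hs0 : 0 ≤ s := (abs_nonneg x).trans hs.le
      refine ⟨√(s ^ 2 - x ^ 2), Real.sqrt_pos.mpr (by linarith), ?_⟩
      simp only
      rw [Real.sq_sqrt (by linarith)]
      simp [Real.sqrt_sq hs0]
  have hder : ∀ r ∈ Ioi (0 : ℝ), HasDerivWithinAt (fun r : ℝ => √(x ^ 2 + r ^ 2))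
      (r / √(x ^ 2 + r ^ 2)) (Ioi 0) r := by
    intro r (hr : 0 < r)
    have h1 : HasDerivAt (fun r : ℝ => x ^ 2 + r ^ 2) (2 * r) r := by
      simpa using (hasDerivAt_pow 2 r).const_add (x ^ 2)
    have h2 := (h1.sqrt (by positivity)).hasDerivWithinAt (s := Ioi 0)
    rwa [mul_div_mul_left _ _ two_ne_zero] at h2
  have hinj : InjOn (fun r : ℝ => √(x ^ 2 + r ^ 2)) (Ioi 0) := by
    intro a (ha : 0 < a) b (hb : 0 < b) hab
    simp only at hab
    rw [Real.sqrt_inj (by positivity) (by positivity)] at hab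
    exact (pow_left_inj₀ ha.le hb.le two_ne_zero).mp (by linarith)
  rw [← himg, integral_image_eq_integral_abs_deriv_smul measurableSet_Ioi hder hinj]
  simp only [finrank_euclideanSpace, Fintype.card_fin, Nat.add_one_sub_one, pow_one]
  rw [← Nat.cast_smul_eq_nsmul ℝ, smul_smul]
  congr 1
  refine setIntegral_congr_fun measurableSet_Ioi fun r (hr : 0 < r) => ?_
  have : 0 < √(x ^ 2 + r ^ 2) := Real.sqrt_pos.mpr (by positivity)
  rw [smul_smul, abs_of_pos (by positivity), div_mul_cancel₀ _ this.ne']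

/-- By Archimedes, the area of a sphere projects uniformly onto a diameter; this integral along the
axis thus produces the spherical average `sinc (κ s)` of the plane wave. -/
lemma integral_Ioo_cexp (κ : ℝ) {s : ℝ} (hs : 0 < s) :
    ∫ x in Ioo (-s) s, Complex.exp (-(κ * x : ℝ) * Complex.I) = (2 * s * Real.sinc (κ * s) : ℝ) := by
  rw [← integral_Ioc_eq_integral_Ioo, ← intervalIntegral.integral_of_le (by linarith)]
  rcases eq_or_ne κ 0 with rfl | hκ
  · simp; ring
  · have h := intervalIntegral.integral_comp_mul_left (a := -s) (b := s)
      (fun t : ℝ => Complex.exp (t * Complex.I)) (c := -κ) (neg_ne_zero.mpr hκ)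
    have h2 := integral_exp_mul_I_eq_sinc (-κ * s)
    have e : -κ * -s = -(-κ * s) := by ring
    rw [e, h2] at h
    have e2 : ∀ x : ℝ, ((-κ * x : ℝ) : ℂ) = -(κ * x : ℝ) := fun x => by push_cast; ring
    simp only [e2] at h
    rw [h, neg_mul, Real.sinc_neg, Complex.real_smul]
    push_cast
    have : (κ : ℂ) ≠ 0 := by exact_mod_cast hκ
    field_simp

/-- The Fourier transform of a radial function on `ℝ³`. -/
lemma fourier_radial {F : ℝ → ℂ} (hF : Measurable F)
    (hi : IntegrableOn (fun r : ℝ => r ^ 2 • F r) (Ioi 0)) (ξ : E3) :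
    𝓕 (fun z : E3 => F ‖z‖) ξ =
      ∫ r in Ioi (0 : ℝ), (4 * Real.pi * r ^ 2 * Real.sinc (2 * Real.pi * ‖ξ‖ * r)) • F r := by
  set κ : ℝ := 2 * Real.pi * ‖ξ‖ with hκ
  obtain ⟨e, he⟩ := exists_isometry_axis ξ
  have hFi : Integrable (fun z : E3 => F ‖z‖) := by
    rw [integrable_fun_norm_addHaar]; simpa using hi
  let H : ℝ × EuclideanSpace ℝ (Fin 2) → ℂ := fun p =>
    Complex.exp (-(κ * p.1 : ℝ) * Complex.I) * F (√(p.1 ^ 2 + ‖p.2‖ ^ 2))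
  let Ψ : E3 → ℝ × EuclideanSpace ℝ (Fin 2) := fun z => WithLp.ofLp (e z)
  have hΨ : MeasurePreserving Ψ := (WithLp.volume_preserving_ofLp _ _).comp e.measurePreserving
  have hΨe : MeasurableEmbedding Ψ :=
    (MeasurableEquiv.toLp 2 _).symm.measurableEmbedding.comp
      e.toHomeomorph.measurableEmbedding
  have hz (z : E3) : √((Ψ z).1 ^ 2 + ‖(Ψ z).2‖ ^ 2) = ‖z‖ := by
    rw [← e.norm_map z, WithLp.prod_norm_eq_of_L2]
    simp [Ψ]
  have hin (z : E3) : inner ℝ z ξ = (Ψ z).1 * ‖ξ‖ := by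
    rw [← e.inner_map_map, he, WithLp.prod_inner_apply]
    simp [Ψ, mul_comm]
  have h1 : 𝓕 (fun z : E3 => F ‖z‖) ξ = ∫ p, H p := by
    rw [← hΨ.integral_comp hΨe, Real.fourier_eq']
    refine integral_congr_ae (ae_of_all _ fun z => ?_)
    simp only [H, hz, hin, smul_eq_mul, hκ]
    congr 2
    push_cast
    ring
  have hHi : Integrable H := by
    rw [← hΨ.integrable_comp_emb hΨe]
    refine (hFi.bdd_mul (f := fun z => Complex.exp (-(κ * (Ψ z).1 : ℝ) * Complex.I)) (c := 1)
      ?_ (ae_of_all _ fun z => ?_)).congr (ae_of_all _ fun z => ?_)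
    · have := hΨ.measurable
      exact Measurable.aestronglyMeasurable (by fun_prop)
    · rw [← Complex.ofReal_neg, Complex.norm_exp_ofReal_mul_I]
    · simp only [H, Function.comp_apply, hz]
  -- The condition `s > |x|` is written as the indicator of `-s < x < s`, so that the two
  -- integrations can be exchanged.
  have h2 : ∫ p, H p = ∫ x : ℝ, (2 * Real.pi) • ∫ s in Ioi (0 : ℝ),
      (Ioo (-s) s).indicator (fun x : ℝ => Complex.exp (-(κ * x : ℝ) * Complex.I)) x * (s • F s) := by
    rw [Measure.volume_eq_prod, integral_prod _ hHi]
    refine integral_congr_ae (ae_of_all _ fun x => ?_)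
    simp only [H]
    rw [integral_const_mul, integral_radial_plane, mul_smul_comm, ← integral_const_mul]
    congr 1
    rw [← integral_indicator measurableSet_Ioi, ← integral_indicator measurableSet_Ioi]
    refine integral_congr_ae (ae_of_all _ fun s => ?_)
    simp only [indicator_apply, mem_Ioi, mem_Ioo]
    by_cases h : |x| < s
    · have h' := abs_lt.mp h
      have : 0 < s := (abs_nonneg x).trans_lt h
      simp [h, h', this]
    · have h' : ¬ (-s < x ∧ x < s) := fun h' => h (abs_lt.mpr h')
      simp [h, h']
  rw [h1, h2, integral_smul, integral_integral_swap]
  · rw [← integral_smul]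
    refine setIntegral_congr_fun measurableSet_Ioi fun s (hs : 0 < s) => ?_
    rw [integral_mul_const, integral_indicator measurableSet_Ioo, integral_Ioo_cexp κ hs]
    simp only [Complex.real_smul]
    push_cast
    ring
  · have hm : Measurable fun p : ℝ × ℝ =>
        (Ioo (-p.2) p.2).indicator (fun x : ℝ => Complex.exp (-(κ * x : ℝ) * Complex.I)) p.1 *
          (p.2 • F p.2) := by
      have hs : MeasurableSet {p : ℝ × ℝ | p.1 ∈ Ioo (-p.2) p.2} :=
        (measurableSet_lt measurable_snd.neg measurable_fst).inter
          (measurableSet_lt measurable_fst measurable_snd)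
      refine Measurable.mul (Measurable.indicator (f := fun p : ℝ × ℝ =>
        Complex.exp (-(κ * p.1 : ℝ) * Complex.I)) (by fun_prop) hs) (by fun_prop)
    refine (integrable_prod_iff' hm.aestronglyMeasurable).mpr ⟨ae_of_all _ fun s => ?_, ?_⟩
    · refine Integrable.mul_const (𝕜 := ℂ) (f := (Ioo (-s) s).indicator
        (fun x : ℝ => Complex.exp (-(κ * x : ℝ) * Complex.I))) ?_ (s • F s)
      rw [integrable_indicator_iff measurableSet_Ioo]
      exact ((by fun_prop : Continuous fun x : ℝ =>
        Complex.exp (-(κ * x : ℝ) * Complex.I)).integrableOn_Icc).mono_set Ioo_subset_Icc_self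
    -- The slice has length `2s`, so the integral of the norm over `x` is `2 s² ‖F s‖`, integrable
    -- by `hi`.
    · refine IntegrableOn.congr_fun (hi.norm.const_mul 2) (fun s (hs : 0 < s) => ?_)
        measurableSet_Ioi
      simp only [norm_mul, norm_indicator_eq_indicator_norm, ← Complex.ofReal_neg,
        Complex.norm_exp_ofReal_mul_I, norm_smul, Real.norm_eq_abs, abs_of_pos hs, abs_pow]
      rw [integral_mul_const, integral_indicator measurableSet_Ioo]
      simp [hs.le]
      ring

end Scattering
end

/-! ### Symbols of the truncated and of the full free resolvent kernel. -/

noncomputable section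

namespace Scattering

open FourierTransform Set

/-- The radial profile of the free resolvent kernel. -/
def freeProfile (lam : ℂ) (r : ℝ) : ℂ :=
  Complex.exp (Complex.I * lam * r) / (4 * (Real.pi : ℂ) * r)

lemma freeKernel_eq (lam : ℂ) (x y : E3) : freeKernel lam x y = freeProfile lam ‖x - y‖ := rfl

@[fun_prop]
lemma measurable_freeProfile (lam : ℂ) : Measurable (freeProfile lam) := by
  unfold freeProfile; fun_prop

/-- The function is `sin (κ r) / κ`; the form with `sinc` remains valid at `κ = 0`. -/
lemma hasDerivAt_mul_sinc (κ r : ℝ) :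
    HasDerivAt (fun r : ℝ => r * Real.sinc (κ * r)) (Real.cos (κ * r)) r := by
  rcases eq_or_ne κ 0 with rfl | hκ
  · simpa using hasDerivAt_id' r
  · have e : (fun r : ℝ => r * Real.sinc (κ * r)) = fun r => Real.sin (κ * r) / κ := by
      funext r
      rcases eq_or_ne r 0 with rfl | hr
      · simp
      · rw [Real.sinc_of_ne_zero (mul_ne_zero hκ hr)]; field_simp
    rw [e]
    have h := ((hasDerivAt_id r).const_mul κ).sin.div_const κ
    simpa [hκ] using h

lemma hasDerivAt_cexp_mul (lam : ℂ) (r : ℝ) :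
    HasDerivAt (fun r : ℝ => Complex.exp (Complex.I * lam * r))
      (Complex.I * lam * Complex.exp (Complex.I * lam * r)) r := by
  have h := ((Complex.ofRealCLM.hasDerivAt (x := r)).const_mul (Complex.I * lam)).cexp
  simpa [mul_comm] using h

lemma norm_cexp_mul (lam : ℂ) (r : ℝ) :
    ‖Complex.exp (Complex.I * lam * r)‖ = Real.exp (-lam.im * r) := by
  rw [Complex.norm_exp]; simp

lemma norm_cexp_mul_le (lam : ℂ) {r T : ℝ} (h0 : 0 ≤ r) (hT : r ≤ T) :
    ‖Complex.exp (Complex.I * lam * r)‖ ≤ Real.exp (T * max (-lam.im) 0) := by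
  rw [norm_cexp_mul, Real.exp_le_exp]
  calc -lam.im * r ≤ max (-lam.im) 0 * r := by gcongr; exact le_max_left _ _
    _ ≤ max (-lam.im) 0 * T := by gcongr
    _ = _ := mul_comm _ _

/-- The Fourier transform of the free resolvent kernel truncated to the ball of radius `T`. -/
def symb (T : ℝ) (lam : ℂ) (ξ : E3) : ℂ :=
  ∫ r in (0 : ℝ)..T, Complex.exp (Complex.I * lam * r) *
    ((r * Real.sinc (2 * Real.pi * ‖ξ‖ * r) : ℝ) : ℂ)

/-- The derivative of `symb` with respect to the spectral parameter. -/
def symbDeriv (T : ℝ) (lam : ℂ) (ξ : E3) : ℂ :=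
  ∫ r in (0 : ℝ)..T, Complex.I * r * Complex.exp (Complex.I * lam * r) *
    ((r * Real.sinc (2 * Real.pi * ‖ξ‖ * r) : ℝ) : ℂ)

lemma continuous_symb (T : ℝ) (lam : ℂ) : Continuous (symb T lam) := by
  refine intervalIntegral.continuous_parametric_intervalIntegral_of_continuous' ?_ 0 T
  have := Real.continuous_sinc
  unfold Function.uncurry
  fun_prop

lemma continuous_symbDeriv (T : ℝ) (lam : ℂ) : Continuous (symbDeriv T lam) := by
  refine intervalIntegral.continuous_parametric_intervalIntegral_of_continuous' ?_ 0 T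
  have := Real.continuous_sinc
  unfold Function.uncurry
  fun_prop

lemma norm_mul_sinc_le (κ : ℝ) {r : ℝ} (hr : 0 ≤ r) :
    ‖((r * Real.sinc (κ * r) : ℝ) : ℂ)‖ ≤ r := by
  rw [Complex.norm_real, norm_mul, Real.norm_of_nonneg hr]
  exact mul_le_of_le_one_right hr (Real.abs_sinc_le_one _)

/-- The factor `1/|λ|` comes from integrating `e^{iλr}` by parts. The boundary term at `0` vanishes,
the one at `T` carries a factor at most `T`, and the derivative of the other factor is a cosine,
bounded by `1` uniformly in `ξ`. -/
lemma norm_symb_le {T : ℝ} (hT : 0 ≤ T) {lam : ℂ} (hl : lam ≠ 0) (ξ : E3) :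
    ‖symb T lam ξ‖ ≤ 2 * T * Real.exp (T * max (-lam.im) 0) / ‖lam‖ := by
  set κ : ℝ := 2 * Real.pi * ‖ξ‖
  set M := Real.exp (T * max (-lam.im) 0)
  -- `G` is the boundary term and `D` the remaining integrand: `G'` is the integrand of `symb` plus
  -- `D`.
  let G : ℝ → ℂ := fun r => Complex.exp (Complex.I * lam * r) *
    ((r * Real.sinc (κ * r) : ℝ) : ℂ) / (Complex.I * lam)
  let D : ℝ → ℂ := fun r => Complex.exp (Complex.I * lam * r) * (Real.cos (κ * r) : ℂ) /
    (Complex.I * lam)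
  have hI : Complex.I * lam ≠ 0 := mul_ne_zero Complex.I_ne_zero hl
  have hn : ‖Complex.I * lam‖ = ‖lam‖ := by simp
  have hc := Real.continuous_sinc
  have c1 : Continuous fun r : ℝ => Complex.exp (Complex.I * lam * r) *
    ((r * Real.sinc (κ * r) : ℝ) : ℂ) := by fun_prop
  have c2 : Continuous D := by fun_prop
  have hG : ∀ r ∈ uIcc 0 T, HasDerivAt G (Complex.exp (Complex.I * lam * r) *
    ((r * Real.sinc (κ * r) : ℝ) : ℂ) + D r) r := by
    intro r _
    have h := ((hasDerivAt_cexp_mul lam r).mul (hasDerivAt_mul_sinc κ r).ofReal_comp).div_const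
      (Complex.I * lam)
    refine h.congr_deriv ?_
    simp only [D]
    field_simp
  have h := intervalIntegral.integral_eq_sub_of_hasDerivAt hG ((c1.add c2).intervalIntegrable _ _)
  rw [intervalIntegral.integral_add (c1.intervalIntegrable _ _) (c2.intervalIntegrable _ _)] at h
  have h0 : G 0 = 0 := by simp [G]
  have hs : symb T lam ξ = G T - ∫ r in (0 : ℝ)..T, D r := by
    rw [h0, sub_zero] at h
    exact eq_sub_of_add_eq h
  have b1 : ‖G T‖ ≤ M * T / ‖lam‖ := by
    simp only [G, norm_div, norm_mul, hn]
    gcongr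
    · simpa only [norm_mul] using norm_cexp_mul_le lam hT le_rfl
    · simpa using norm_mul_sinc_le κ hT
  have b2 : ‖∫ r in (0 : ℝ)..T, D r‖ ≤ M / ‖lam‖ * |T - 0| := by
    refine intervalIntegral.norm_integral_le_of_norm_le_const fun r hr => ?_
    rw [uIoc_of_le hT] at hr
    simp only [D, norm_div, hn]
    gcongr
    rw [norm_mul]
    refine (mul_le_of_le_one_right (norm_nonneg _) ?_).trans (norm_cexp_mul_le lam hr.1.le hr.2)
    rw [Complex.norm_real]; exact Real.abs_cos_le_one _
  rw [hs]
  rw [sub_zero, abs_of_nonneg hT] at b2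
  calc _ ≤ _ := norm_sub_le _ _
    _ ≤ _ := add_le_add b1 b2
    _ = _ := by ring

/-- Here `κ r sinc (κ r) = sin (κ r)` is bounded, so one derivative costs exactly the gain `1/|λ|`,
and no integration by parts is needed. -/
lemma norm_mul_symb_le {T : ℝ} (hT : 0 ≤ T) (lam : ℂ) (ξ : E3) :
    2 * Real.pi * ‖ξ‖ * ‖symb T lam ξ‖ ≤ T * Real.exp (T * max (-lam.im) 0) := by
  set κ : ℝ := 2 * Real.pi * ‖ξ‖ with hκ
  have hκ0 : 0 ≤ κ := by positivity
  have e : κ * ‖symb T lam ξ‖ = ‖(κ : ℂ) * symb T lam ξ‖ := by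
    rw [norm_mul, Complex.norm_real, Real.norm_of_nonneg hκ0]
  rw [e, symb, ← intervalIntegral.integral_const_mul, mul_comm T]
  have b : ‖∫ r in (0 : ℝ)..T, (κ : ℂ) * (Complex.exp (Complex.I * lam * r) *
      ((r * Real.sinc (2 * Real.pi * ‖ξ‖ * r) : ℝ) : ℂ))‖ ≤
      Real.exp (T * max (-lam.im) 0) * |T - 0| := by
    refine intervalIntegral.norm_integral_le_of_norm_le_const fun r hr => ?_
    rw [uIoc_of_le hT] at hr
    have : (κ : ℂ) * (Complex.exp (Complex.I * lam * r) *
      ((r * Real.sinc (2 * Real.pi * ‖ξ‖ * r) : ℝ) : ℂ)) =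
      Complex.exp (Complex.I * lam * r) * ((κ * r * Real.sinc (κ * r) : ℝ) : ℂ) := by
      rw [← hκ]; push_cast; ring
    rw [this, norm_mul]
    refine (mul_le_of_le_one_right (norm_nonneg _) ?_).trans (norm_cexp_mul_le lam hr.1.le hr.2)
    rw [Complex.norm_real]
    rcases eq_or_ne (κ * r) 0 with h | h
    · simp [h]
    · rw [Real.sinc_of_ne_zero h, mul_div_cancel₀ _ h]
      exact Real.abs_sin_le_one _
  rwa [sub_zero, abs_of_nonneg hT] at b

/-- A crude bound without integration by parts, which also covers `λ = 0`; it puts the symbol in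
`L^∞` for every `λ`. -/
lemma norm_symb_le_of_bound {T : ℝ} (hT : 0 ≤ T) (lam : ℂ) (ξ : E3) :
    ‖symb T lam ξ‖ ≤ Real.exp (T * max (-lam.im) 0) * T * T := by
  have b := intervalIntegral.norm_integral_le_of_norm_le_const (a := 0) (b := T)
    (C := Real.exp (T * max (-lam.im) 0) * T)
    (f := fun r : ℝ => Complex.exp (Complex.I * lam * r) *
      ((r * Real.sinc (2 * Real.pi * ‖ξ‖ * r) : ℝ) : ℂ)) fun r hr => by
    rw [uIoc_of_le hT] at hr
    rw [norm_mul]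
    exact mul_le_mul (norm_cexp_mul_le lam hr.1.le hr.2)
      ((norm_mul_sinc_le _ hr.1.le).trans hr.2) (norm_nonneg _) (Real.exp_pos _).le
  rwa [sub_zero, abs_of_nonneg hT] at b

lemma norm_symbDeriv_le {T : ℝ} (hT : 0 ≤ T) (lam : ℂ) (ξ : E3) :
    ‖symbDeriv T lam ξ‖ ≤ T * Real.exp (T * max (-lam.im) 0) * T * T := by
  have b := intervalIntegral.norm_integral_le_of_norm_le_const (a := 0) (b := T)
    (C := T * Real.exp (T * max (-lam.im) 0) * T)
    (f := fun r : ℝ => Complex.I * r * Complex.exp (Complex.I * lam * r) *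
      ((r * Real.sinc (2 * Real.pi * ‖ξ‖ * r) : ℝ) : ℂ)) fun r hr => by
    rw [uIoc_of_le hT] at hr
    rw [norm_mul, norm_mul]
    refine mul_le_mul (mul_le_mul ?_ (norm_cexp_mul_le lam hr.1.le hr.2) (norm_nonneg _) hT)
      ((norm_mul_sinc_le _ hr.1.le).trans hr.2) (norm_nonneg _) (by positivity)
    simpa [abs_of_pos hr.1] using hr.2
  rwa [sub_zero, abs_of_nonneg hT] at b

/-- Second order Taylor remainder of `e^{ihr}`, for `r ≤ T`. It is uniform in `ξ`, which gives
differentiability in the `L^∞` norm. -/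
lemma norm_symb_sub_le {T : ℝ} (hT : 0 ≤ T) (lam : ℂ) {h : ℂ} (hh : ‖h‖ * T ≤ 1) (ξ : E3) :
    ‖symb T (lam + h) ξ - symb T lam ξ - h * symbDeriv T lam ξ‖ ≤
      Real.exp (T * max (-lam.im) 0) * T ^ 4 * ‖h‖ ^ 2 := by
  have hc := Real.continuous_sinc
  have c (lam : ℂ) : Continuous fun r : ℝ => Complex.exp (Complex.I * lam * r) *
    ((r * Real.sinc (2 * Real.pi * ‖ξ‖ * r) : ℝ) : ℂ) := by fun_prop
  have c' : Continuous fun r : ℝ => h * (Complex.I * r * Complex.exp (Complex.I * lam * r) *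
    ((r * Real.sinc (2 * Real.pi * ‖ξ‖ * r) : ℝ) : ℂ)) := by fun_prop
  rw [symb, symb, symbDeriv, ← intervalIntegral.integral_const_mul,
    ← intervalIntegral.integral_sub ((c _).intervalIntegrable _ _) ((c _).intervalIntegrable _ _),
    ← intervalIntegral.integral_sub (((c _).intervalIntegrable _ _).sub
      ((c _).intervalIntegrable _ _)) (c'.intervalIntegrable _ _)]
  have b : ∀ r ∈ uIoc 0 T, ‖Complex.exp (Complex.I * (lam + h) * r) *
      ((r * Real.sinc (2 * Real.pi * ‖ξ‖ * r) : ℝ) : ℂ) - Complex.exp (Complex.I * lam * r) *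
      ((r * Real.sinc (2 * Real.pi * ‖ξ‖ * r) : ℝ) : ℂ) -
      h * (Complex.I * r * Complex.exp (Complex.I * lam * r) *
      ((r * Real.sinc (2 * Real.pi * ‖ξ‖ * r) : ℝ) : ℂ))‖ ≤
      Real.exp (T * max (-lam.im) 0) * (‖h‖ * T) ^ 2 * T := by
    intro r hr
    rw [uIoc_of_le hT] at hr
    have e : Complex.exp (Complex.I * (lam + h) * r) *
      ((r * Real.sinc (2 * Real.pi * ‖ξ‖ * r) : ℝ) : ℂ) - Complex.exp (Complex.I * lam * r) *
      ((r * Real.sinc (2 * Real.pi * ‖ξ‖ * r) : ℝ) : ℂ) -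
      h * (Complex.I * r * Complex.exp (Complex.I * lam * r) *
      ((r * Real.sinc (2 * Real.pi * ‖ξ‖ * r) : ℝ) : ℂ)) = Complex.exp (Complex.I * lam * r) *
      (Complex.exp (Complex.I * h * r) - 1 - Complex.I * h * r) *
      ((r * Real.sinc (2 * Real.pi * ‖ξ‖ * r) : ℝ) : ℂ) := by
      have : Complex.I * (lam + h) * r = Complex.I * lam * r + Complex.I * h * r := by ring
      rw [this, Complex.exp_add]; ring
    have hn : ‖Complex.I * h * r‖ ≤ ‖h‖ * T := by
      simp only [norm_mul, Complex.norm_I, one_mul, Complex.norm_real, Real.norm_eq_abs,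
        abs_of_pos hr.1]
      gcongr; exact hr.2
    rw [e, norm_mul, norm_mul]
    refine mul_le_mul (mul_le_mul (norm_cexp_mul_le lam hr.1.le hr.2) ?_ (norm_nonneg _)
      (Real.exp_pos _).le) ((norm_mul_sinc_le _ hr.1.le).trans hr.2) (norm_nonneg _) (by positivity)
    exact (Complex.norm_exp_sub_one_sub_id_le (hn.trans hh)).trans
      (pow_le_pow_left₀ (norm_nonneg _) hn 2)
  have := intervalIntegral.norm_integral_le_of_norm_le_const b
  rw [sub_zero, abs_of_nonneg hT] at this
  refine this.trans_eq ?_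
  ring

lemma memLp_symb {T : ℝ} (hT : 0 ≤ T) (lam : ℂ) : MemLp (symb T lam) ∞ volume :=
  memLp_top_of_bdd (continuous_symb T lam).measurable (norm_symb_le_of_bound hT lam)

lemma memLp_symbDeriv {T : ℝ} (hT : 0 ≤ T) (lam : ℂ) : MemLp (symbDeriv T lam) ∞ volume :=
  memLp_top_of_bdd (continuous_symbDeriv T lam).measurable (norm_symbDeriv_le hT lam)

/-- Convolution on `L²` with the free resolvent kernel truncated to the ball of radius `T`. -/
def truncOp (T : ℝ) (lam : ℂ) : L2 →L[ℂ] L2 := fourierMult (bddClass (symb T lam))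

lemma norm_truncOp_le {T : ℝ} (hT : 0 ≤ T) {lam : ℂ} (hl : lam ≠ 0) :
    ‖truncOp T lam‖ ≤ 2 * T * Real.exp (T * max (-lam.im) 0) / ‖lam‖ :=
  (norm_fourierMult_le _).trans (norm_bddClass_le (by positivity) (norm_symb_le hT hl))

lemma hasDerivAt_bddClass_symb {T : ℝ} (hT : 0 ≤ T) (lam : ℂ) :
    HasDerivAt (fun lam => bddClass (symb T lam)) (bddClass (symbDeriv T lam)) lam := by
  rw [hasDerivAt_iff_isLittleO_nhds_zero]
  have hO : (fun h : ℂ => bddClass (symb T (lam + h)) - bddClass (symb T lam) -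
      h • bddClass (symbDeriv T lam)) =O[𝓝 0] fun h => ‖h‖ ^ 2 := by
    refine Asymptotics.IsBigO.of_bound (Real.exp (T * max (-lam.im) 0) * T ^ 4) ?_
    have : ∀ᶠ h : ℂ in 𝓝 0, ‖h‖ * T < 1 := by
      have : Tendsto (fun h : ℂ => ‖h‖ * T) (𝓝 0) (𝓝 0) := by
        simpa using (tendsto_norm_zero (E := ℂ)).mul_const T
      exact this.eventually_lt_const one_pos
    filter_upwards [this] with h hh
    have e : bddClass (symb T (lam + h)) - bddClass (symb T lam) - h • bddClass (symbDeriv T lam) =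
        bddClass (fun ξ => symb T (lam + h) ξ - symb T lam ξ - h * symbDeriv T lam ξ) := by
      have hm : MemLp (fun ξ => symb T (lam + h) ξ - symb T lam ξ - h * symbDeriv T lam ξ) ∞
          volume :=
        ((memLp_symb hT _).sub (memLp_symb hT _)).sub ((memLp_symbDeriv hT lam).const_mul h)
      refine Lp.ext ?_
      filter_upwards [Lp.coeFn_sub (bddClass (symb T (lam + h)) - bddClass (symb T lam))
        (h • bddClass (symbDeriv T lam)), Lp.coeFn_sub (bddClass (symb T (lam + h)))
        (bddClass (symb T lam)), Lp.coeFn_smul h (bddClass (symbDeriv T lam)),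
        coeFn_bddClass hm, coeFn_bddClass (memLp_symb hT lam),
        coeFn_bddClass (memLp_symb hT (lam + h)), coeFn_bddClass (memLp_symbDeriv hT lam)]
        with ξ h1 h2 h3 h4 h5 h6 h7
      rw [h1, Pi.sub_apply, h2, Pi.sub_apply, h3, Pi.smul_apply, h4, h5, h6, h7, smul_eq_mul]
    rw [e, norm_pow, norm_norm]
    exact norm_bddClass_le (by positivity) (norm_symb_sub_le hT lam hh.le)
  refine hO.trans_isLittleO ?_
  simpa using (Asymptotics.isLittleO_norm_pow_id (E' := ℂ) one_lt_two)

/-- Since the symbol determines its multiplier linearly and continuously, differentiability passes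
to the operator norm. Truncation makes this hold for all `λ`, also below the real axis; the
holomorphy of the cut-off resolvents rests on it. -/
lemma differentiable_truncOp {T : ℝ} (hT : 0 ≤ T) : Differentiable ℂ (truncOp T) := fun lam =>
  (fourierMult.hasFDerivAt.comp_hasDerivAt lam (hasDerivAt_bddClass_symb hT lam)).differentiableAt

lemma smul_freeProfile (lam : ℂ) {r : ℝ} (hr : 0 < r) (κ : ℝ) :
    (4 * Real.pi * r ^ 2 * Real.sinc (κ * r)) • freeProfile lam r =
      Complex.exp (Complex.I * lam * r) * ((r * Real.sinc (κ * r) : ℝ) : ℂ) := by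
  have h1 : (r : ℂ) ≠ 0 := by exact_mod_cast hr.ne'
  have h2 : (Real.pi : ℂ) ≠ 0 := by exact_mod_cast Real.pi_ne_zero
  rw [freeProfile, Complex.real_smul]
  push_cast
  field_simp

lemma sq_smul_freeProfile (lam : ℂ) {r : ℝ} (hr : 0 < r) :
    r ^ 2 • freeProfile lam r =
      (4 * (Real.pi : ℂ))⁻¹ * (Complex.exp (Complex.I * lam * r) * r) := by
  have h1 : (r : ℂ) ≠ 0 := by exact_mod_cast hr.ne'
  have h2 : (Real.pi : ℂ) ≠ 0 := by exact_mod_cast Real.pi_ne_zero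
  rw [freeProfile, Complex.real_smul]
  push_cast
  field_simp

/-- The free resolvent kernel truncated to the ball of radius `T`. -/
def truncKernel (T : ℝ) (lam : ℂ) (z : E3) : ℂ := (Iic T).indicator (freeProfile lam) ‖z‖

lemma integrableOn_truncProfile (T : ℝ) (lam : ℂ) :
    IntegrableOn (fun r : ℝ => r ^ 2 • (Iic T).indicator (freeProfile lam) r) (Ioi 0) := by
  have h : IntegrableOn (fun r : ℝ => (4 * (Real.pi : ℂ))⁻¹ *
      (Complex.exp (Complex.I * lam * r) * r)) (Ioi 0 ∩ Iic T) := by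
    rw [Ioi_inter_Iic]
    exact (by fun_prop : Continuous fun r : ℝ => (4 * (Real.pi : ℂ))⁻¹ *
      (Complex.exp (Complex.I * lam * r) * r)).integrableOn_Ioc
  rw [inter_comm, IntegrableOn, ← Measure.restrict_restrict measurableSet_Iic, ← IntegrableOn,
    ← integrable_indicator_iff measurableSet_Iic] at h
  refine IntegrableOn.congr_fun h (fun r hr => ?_) measurableSet_Ioi
  by_cases hT : r ≤ T
  · simp only [indicator_of_mem (mem_Iic.mpr hT)]
    exact (sq_smul_freeProfile lam hr).symm
  · simp [hT]

lemma integrable_truncKernel (T : ℝ) (lam : ℂ) : Integrable (truncKernel T lam) := by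
  unfold truncKernel
  rw [integrable_fun_norm_addHaar]
  simpa using integrableOn_truncProfile T lam

lemma fourier_truncKernel {T : ℝ} (hT : 0 ≤ T) (lam : ℂ) :
    𝓕 (truncKernel T lam) = symb T lam := by
  funext ξ
  unfold truncKernel
  rw [fourier_radial ((measurable_freeProfile lam).indicator measurableSet_Iic)
    (integrableOn_truncProfile T lam), symb, intervalIntegral.integral_of_le hT,
    ← Ioi_inter_Iic, ← setIntegral_indicator measurableSet_Iic]
  refine setIntegral_congr_fun measurableSet_Ioi fun r hr => ?_
  by_cases h : r ≤ T
  · simp only [indicator_of_mem (mem_Iic.mpr h)]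
    exact smul_freeProfile lam hr _
  · simp [h]

/-- The Fourier transform of the free resolvent kernel for `Im λ > 0`. -/
def fullSymb (lam : ℂ) (ξ : E3) : ℂ := 1 / (((2 * Real.pi * ‖ξ‖ : ℝ) : ℂ) ^ 2 - lam ^ 2)

lemma sq_sub_sq_ne_zero {lam : ℂ} (hl : 0 < lam.im) (κ : ℝ) : (κ : ℂ) ^ 2 - lam ^ 2 ≠ 0 := by
  intro h
  rcases sq_eq_sq_iff_eq_or_eq_neg.mp (sub_eq_zero.mp h) with h | h
  · rw [← h] at hl; simp at hl
  · have : lam = ((-κ : ℝ) : ℂ) := by rw [Complex.ofReal_neg, h, neg_neg]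
    rw [this] at hl; simp at hl

lemma integrableOn_cexp_mul {lam : ℂ} (hl : 0 < lam.im) :
    IntegrableOn (fun r : ℝ => Complex.exp (Complex.I * lam * r) * r) (Ioi 0) := by
  have h := integrableOn_rpow_mul_exp_neg_mul_rpow (s := 1) (p := 1) (by norm_num) one_pos hl
  refine Integrable.mono' h (by fun_prop) ?_
  filter_upwards [ae_restrict_mem measurableSet_Ioi] with r hr
  rw [norm_mul, norm_cexp_mul, Real.rpow_one, Complex.norm_real, Real.norm_of_nonneg (le_of_lt hr),
    mul_comm]

/-- The integrand has the explicit primitive `G`, which tends to `0` at infinity because `Im λ > 0`;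
the integral is `-G 0`. -/
lemma integral_cexp_mul_sinc {lam : ℂ} (hl : 0 < lam.im) (κ : ℝ) :
    ∫ r in Ioi (0 : ℝ), Complex.exp (Complex.I * lam * r) * ((r * Real.sinc (κ * r) : ℝ) : ℂ) =
      1 / ((κ : ℂ) ^ 2 - lam ^ 2) := by
  have hne := sq_sub_sq_ne_zero hl κ
  have hcs := Real.continuous_sinc
  let G : ℝ → ℂ := fun r => Complex.exp (Complex.I * lam * r) *
    (Complex.I * lam * ((r * Real.sinc (κ * r) : ℝ) : ℂ) - (Real.cos (κ * r) : ℂ)) /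
      ((κ : ℂ) ^ 2 - lam ^ 2)
  have hc (r : ℝ) : HasDerivAt (fun r : ℝ => Real.cos (κ * r)) (-(κ ^ 2 * (r * Real.sinc (κ * r)))) r := by
    have h := ((hasDerivAt_id' r).const_mul κ).cos
    refine h.congr_deriv ?_
    rcases eq_or_ne (κ * r) 0 with h | h
    · rcases mul_eq_zero.mp h with h | h <;> simp [h]
    · rw [Real.sinc_of_ne_zero h]
      obtain ⟨h1, h2⟩ := mul_ne_zero_iff.mp h
      field_simp
  have hG (r : ℝ) : HasDerivAt G
      (Complex.exp (Complex.I * lam * r) * ((r * Real.sinc (κ * r) : ℝ) : ℂ)) r := by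
    have h := ((hasDerivAt_cexp_mul lam r).mul
      (((hasDerivAt_mul_sinc κ r).ofReal_comp.const_mul (Complex.I * lam)).sub
        (hc r).ofReal_comp)).div_const ((κ : ℂ) ^ 2 - lam ^ 2)
    refine h.congr_deriv ?_
    rw [div_eq_iff hne, Pi.sub_apply]
    push_cast
    linear_combination (Complex.exp (Complex.I * lam * r) * lam ^ 2 *
      (r * (Real.sinc (κ * r) : ℂ))) * Complex.I_sq
  have hint : IntegrableOn (fun r : ℝ =>
      Complex.exp (Complex.I * lam * r) * ((r * Real.sinc (κ * r) : ℝ) : ℂ)) (Ioi 0) := by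
    refine Integrable.mono (integrableOn_cexp_mul hl) (by fun_prop) ?_
    filter_upwards [ae_restrict_mem measurableSet_Ioi] with r hr
    rw [norm_mul, norm_mul]
    gcongr
    rw [Complex.norm_real r, Real.norm_of_nonneg (le_of_lt hr)]
    exact norm_mul_sinc_le κ (le_of_lt hr)
  have hlim : Tendsto G atTop (𝓝 0) := by
    have h1 : Tendsto (fun r : ℝ => Real.exp (-lam.im * r) * (‖lam‖ * r + 1) /
        ‖(κ : ℂ) ^ 2 - lam ^ 2‖) atTop (𝓝 0) := by
      have h2 : Tendsto (fun r : ℝ => r ^ 1 * Real.exp (-lam.im * r)) atTop (𝓝 0) := by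
        simpa using tendsto_rpow_mul_exp_neg_mul_atTop_nhds_zero 1 lam.im hl
      have h3 : Tendsto (fun r : ℝ => Real.exp (-lam.im * r)) atTop (𝓝 0) := by
        simpa using tendsto_rpow_mul_exp_neg_mul_atTop_nhds_zero 0 lam.im hl
      have h4 := ((h2.const_mul ‖lam‖).add h3).div_const ‖(κ : ℂ) ^ 2 - lam ^ 2‖
      simp only [mul_zero, add_zero, zero_div] at h4
      refine h4.congr fun r => ?_
      ring
    refine squeeze_zero_norm' ?_ h1
    filter_upwards [eventually_ge_atTop 0] with r hr
    simp only [G, norm_div, norm_mul]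
    rw [norm_cexp_mul]
    gcongr
    refine (norm_sub_le _ _).trans (add_le_add ?_ ?_)
    · rw [norm_mul]
      simp only [norm_mul, Complex.norm_I, one_mul]
      gcongr
      simpa using norm_mul_sinc_le κ hr
    · rw [Complex.norm_real]; exact Real.abs_cos_le_one _
  rw [integral_Ioi_of_hasDerivAt_of_tendsto' (fun r _ => hG r) hint hlim]
  simp [G, neg_div]

lemma integrableOn_freeProfile {lam : ℂ} (hl : 0 < lam.im) :
    IntegrableOn (fun r : ℝ => r ^ 2 • freeProfile lam r) (Ioi 0) :=
  IntegrableOn.congr_fun ((integrableOn_cexp_mul hl).const_mul (4 * (Real.pi : ℂ))⁻¹)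
    (fun _ hr => (sq_smul_freeProfile lam hr).symm) measurableSet_Ioi

lemma integrable_freeProfile_norm {lam : ℂ} (hl : 0 < lam.im) :
    Integrable (fun z : E3 => freeProfile lam ‖z‖) := by
  rw [integrable_fun_norm_addHaar]
  simpa using integrableOn_freeProfile hl

lemma fourier_freeProfile {lam : ℂ} (hl : 0 < lam.im) :
    𝓕 (fun z : E3 => freeProfile lam ‖z‖) = fullSymb lam := by
  funext ξ
  rw [fourier_radial (measurable_freeProfile lam) (integrableOn_freeProfile hl), fullSymb,
    ← integral_cexp_mul_sinc hl]
  exact setIntegral_congr_fun measurableSet_Ioi fun r hr => smul_freeProfile lam hr _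

/-- A Fourier transform is bounded by the `L¹` norm of the kernel, so the fraction need not be
estimated. -/
lemma memLp_fullSymb {lam : ℂ} (hl : 0 < lam.im) : MemLp (fullSymb lam) ∞ volume := by
  refine memLp_top_of_bdd (C := ∫ z : E3, ‖freeProfile lam ‖z‖‖) ?_ fun ξ => ?_
  · unfold fullSymb; fun_prop
  · rw [← fourier_freeProfile hl]
    exact VectorFourier.norm_fourierIntegral_le_integral_norm _ _ _ _ _

end Scattering
end

/-! ### Weak derivatives and the free Helmholtz equation. -/

noncomputable section

namespace Scattering

open FourierTransform LineDeriv Set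
open scoped SchwartzMap

/-- The symbol of the `k`-th partial derivative of `truncOp`. -/
def gradSymb (k : Fin 3) (T : ℝ) (lam : ℂ) (ξ : E3) : ℂ :=
  2 * Real.pi * Complex.I * (inner ℝ ξ (EuclideanSpace.single k (1 : ℝ)) : ℝ) * symb T lam ξ

lemma norm_gradSymb_le (k : Fin 3) {T : ℝ} (hT : 0 ≤ T) (lam : ℂ) (ξ : E3) :
    ‖gradSymb k T lam ξ‖ ≤ T * Real.exp (T * max (-lam.im) 0) := by
  refine le_trans ?_ (norm_mul_symb_le hT lam ξ)
  have h := abs_real_inner_le_norm ξ (EuclideanSpace.single k (1 : ℝ))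
  rw [PiLp.norm_single, norm_one, mul_one] at h
  simp only [gradSymb, norm_mul, Complex.norm_ofNat, Complex.norm_real, Complex.norm_I, mul_one,
    Real.norm_eq_abs, abs_of_pos Real.pi_pos]
  gcongr

lemma memLp_gradSymb (k : Fin 3) {T : ℝ} (hT : 0 ≤ T) (lam : ℂ) :
    MemLp (gradSymb k T lam) ∞ volume := by
  refine memLp_top_of_bdd ?_ (norm_gradSymb_le k hT lam)
  have := (continuous_symb T lam).measurable
  unfold gradSymb
  fun_prop

/-- The `k`-th partial derivative of `truncOp`. -/
def gradOp (k : Fin 3) (T : ℝ) (lam : ℂ) : L2 →L[ℂ] L2 := fourierMult (bddClass (gradSymb k T lam))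

lemma norm_gradOp_le (k : Fin 3) {T : ℝ} (hT : 0 ≤ T) (lam : ℂ) :
    ‖gradOp k T lam‖ ≤ T * Real.exp (T * max (-lam.im) 0) :=
  (norm_fourierMult_le _).trans (norm_bddClass_le (by positivity) (norm_gradSymb_le k hT lam))

lemma hasWeakPartial_truncOp (k : Fin 3) {T : ℝ} (hT : 0 ≤ T) (lam : ℂ) (f : L2) :
    HasWeakPartial k (truncOp T lam f) (gradOp k T lam f) := by
  intro φ hφ
  let ψ : 𝓢(E3, ℂ) := hφ.2.toSchwartzMap hφ.1
  have h1 := integral_fourierMult_mul (bddClass (symb T lam)) f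
    (∂_{EuclideanSpace.single k (1 : ℝ)} ψ)
  have h2 := integral_fourierMult_mul (bddClass (gradSymb k T lam)) f ψ
  simp only [SchwartzMap.lineDerivOp_apply_eq_fderiv] at h1
  refine h1.trans (Eq.trans ?_ (congrArg Neg.neg h2.symm))
  rw [← integral_neg]
  refine integral_congr_ae ?_
  filter_upwards [coeFn_bddClass (memLp_symb hT lam), coeFn_bddClass (memLp_gradSymb k hT lam)]
    with ξ e1 e2
  rw [e1, e2, fourierInv_lineDeriv, gradSymb]
  ring

/-- The Helmholtz operator `-Δ - λ²` on Schwartz functions. -/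
def helmholtz (lam : ℂ) (φ : 𝓢(E3, ℂ)) : 𝓢(E3, ℂ) := -(Δ φ) - lam ^ 2 • φ

lemma helmholtz_apply (lam : ℂ) (φ : 𝓢(E3, ℂ)) (x : E3) :
    helmholtz lam φ x = -(Δ (φ : E3 → ℂ)) x - lam ^ 2 * φ x := by
  simp [helmholtz, SchwartzMap.laplacian_apply]

lemma fourierInv_helmholtz (lam : ℂ) (φ : 𝓢(E3, ℂ)) (ξ : E3) :
    (𝓕⁻ (helmholtz lam φ)) ξ =
      (((2 * Real.pi * ‖ξ‖ : ℝ) : ℂ) ^ 2 - lam ^ 2) * (𝓕⁻ φ) ξ := by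
  have h : 𝓕⁻ (helmholtz lam φ) = -(𝓕⁻ (Δ φ)) - lam ^ 2 • 𝓕⁻ φ := by
    change fourierInvCLM ℂ 𝓢(E3, ℂ) (helmholtz lam φ) = _
    rw [helmholtz, map_sub, map_neg, map_smul]
    rfl
  rw [h]
  simp only [sub_apply, neg_apply, smul_apply,
    fourierInv_laplacian, smul_eq_mul]
  ring

/-- The `L²` resolvent of the free Laplacian. -/
def freeOp (lam : ℂ) : L2 →L[ℂ] L2 := fourierMult (bddClass (fullSymb lam))

lemma integral_freeOp_mul_helmholtz {lam : ℂ} (hl : 0 < lam.im) (f : L2) (φ : 𝓢(E3, ℂ)) :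
    ∫ x, freeOp lam f x * helmholtz lam φ x = ∫ x, f x * φ x := by
  rw [integral_mul_eq_integral_fourier f φ, freeOp, integral_fourierMult_mul]
  refine integral_congr_ae ?_
  filter_upwards [coeFn_bddClass (memLp_fullSymb hl)] with ξ e1
  rw [e1, fourierInv_helmholtz, fullSymb]
  have := sq_sub_sq_ne_zero hl (2 * Real.pi * ‖ξ‖)
  field_simp

/-- On the Fourier side the hypothesis says that `𝓕 v` times `κ² - λ²` vanishes, and this factor has
no zero when `Im λ > 0`. -/
lemma eq_zero_of_integral_mul_helmholtz {lam : ℂ} (hl : 0 < lam.im) {v : L2}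
    (h : ∀ φ, ∫ x, v x * helmholtz lam φ x = 0) : v = 0 := by
  have hz : (fun ξ : E3 => (𝓕 v : L2) ξ * (((2 * Real.pi * ‖ξ‖ : ℝ) : ℂ) ^ 2 - lam ^ 2))
      =ᵐ[volume] 0 := by
    refine locallyIntegrable_ae_eq_zero ?_ fun φ => ?_
    · have h1 : LocallyIntegrable (𝓕 v : L2) volume :=
        (Lp.memLp _).locallyIntegrable one_le_two
      rw [← locallyIntegrableOn_univ] at h1 ⊢
      exact h1.mul_continuousOn (by fun_prop) isOpen_univ.isLocallyClosed
    · have h1 := h (𝓕 φ)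
      rw [integral_mul_eq_integral_fourier] at h1
      rw [← h1]
      refine integral_congr_ae (ae_of_all _ fun ξ => ?_)
      simp only
      rw [fourierInv_helmholtz, fourierInv_fourier_eq, mul_assoc]
  have hv : (𝓕 v : L2) = 0 := by
    refine (Lp.eq_zero_iff_ae_eq_zero).mpr ?_
    filter_upwards [hz] with ξ hξ
    exact (mul_eq_zero.mp hξ).resolve_right (sq_sub_sq_ne_zero hl _)
  rw [← norm_eq_zero, ← Lp.norm_fourier_eq, hv, norm_zero]

lemma norm_iteratedFDeriv_comp_smul_le {f : E3 → ℂ} (hf : ContDiff ℝ ∞ f) {c : ℝ} (h0 : 0 ≤ c)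
    (h1 : c ≤ 1) (i : ℕ) (x : E3) :
    ‖iteratedFDeriv ℝ i (fun y => f (c • y)) x‖ ≤ ‖iteratedFDeriv ℝ i f (c • x)‖ := by
  have e := (c • ContinuousLinearMap.id ℝ E3).iteratedFDeriv_comp_right hf x (i := i)
    (by exact_mod_cast le_top)
  have e' : f ∘ (c • ContinuousLinearMap.id ℝ E3) = fun y => f (c • y) := by
    funext y; simp
  rw [e'] at e
  rw [e]
  refine (ContinuousMultilinearMap.norm_compContinuousLinearMap_le _ _).trans ?_
  simp only [smul_apply, ContinuousLinearMap.id_apply]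
  refine mul_le_of_le_one_right (norm_nonneg _) (Finset.prod_le_one (fun _ _ => norm_nonneg _) ?_)
  intro _ _
  refine ContinuousLinearMap.opNorm_le_bound _ zero_le_one fun y => ?_
  simp only [smul_apply, ContinuousLinearMap.id_apply, norm_smul,
    Real.norm_of_nonneg h0]
  gcongr

lemma norm_laplacian_le (f : E3 → ℂ) (x : E3) :
    ‖(Δ f) x‖ ≤ 3 * ‖iteratedFDeriv ℝ 2 f x‖ := by
  rw [InnerProductSpace.laplacian_eq_iteratedFDeriv_orthonormalBasis f
    (EuclideanSpace.basisFun (Fin 3) ℝ)]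
  refine (norm_sum_le_of_le (n := fun _ => ‖iteratedFDeriv ℝ 2 f x‖) _ fun i _ => ?_).trans ?_
  · refine (ContinuousMultilinearMap.le_opNorm _ _).trans_eq ?_
    simp
  · simp

/-- The vanishing of `(-Δ - λ²)v` can be tested on Schwartz functions. -/
lemma integral_mul_helmholtz_of_isTest {lam : ℂ} {v : L2}
    (h : ∀ φ : E3 → ℂ, IsTest φ → ∫ x, v x * (-(Δ φ) x - lam ^ 2 * φ x) = 0) (φ : 𝓢(E3, ℂ)) :
    ∫ x, v x * helmholtz lam φ x = 0 := by
  -- `φ` is approximated by `χ (c n • x) φ x`, where `c n = 1/(n+1)` and the cut-off is `1` on the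
  -- ball of radius `n + 1`. As `c n ≤ 1`, the derivatives of the cut-offs are bounded uniformly in
  -- `n`.
  let b : ContDiffBump (0 : E3) := ⟨1, 2, one_pos, one_lt_two⟩
  let χ : E3 → ℂ := fun x => ((b x : ℝ) : ℂ)
  have hχ : ContDiff ℝ ∞ χ := Complex.ofRealCLM.contDiff.comp b.contDiff
  have hχc : HasCompactSupport χ := b.hasCompactSupport.comp_left (g := fun r : ℝ => (r : ℂ)) rfl
  let X : 𝓢(E3, ℂ) := hχc.toSchwartzMap hχ
  let c : ℕ → ℝ := fun n => ((n : ℝ) + 1)⁻¹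
  have hc0 (n : ℕ) : 0 < c n := by positivity
  have hc1 (n : ℕ) : c n ≤ 1 := inv_le_one_of_one_le₀ (by linarith [n.cast_nonneg (α := ℝ)])
  let ψ : ℕ → E3 → ℂ := fun n x => χ (c n • x) * φ x
  have hsm (n : ℕ) : ContDiff ℝ ∞ fun x : E3 => χ (c n • x) := hχ.comp (contDiff_const_smul _)
  have hψ (n : ℕ) : IsTest (ψ n) :=
    ⟨(hsm n).mul (φ.smooth ⊤), (hχc.comp_smul (hc0 n).ne').mul_right⟩
  let C : ℕ → ℝ := fun i => SchwartzMap.seminorm ℝ 0 i X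
  have hC (i n : ℕ) (x : E3) : ‖iteratedFDeriv ℝ i (fun y => χ (c n • y)) x‖ ≤ C i :=
    (norm_iteratedFDeriv_comp_smul_le hχ (hc0 n).le (hc1 n) i x).trans
      (X.norm_iteratedFDeriv_le_seminorm ℝ i _)
  have hC0 (i : ℕ) : 0 ≤ C i := apply_nonneg _ _
  let φ1 := SchwartzMap.fderivCLM ℝ E3 ℂ φ
  let φ2 := SchwartzMap.fderivCLM ℝ E3 (E3 →L[ℝ] ℂ) φ1
  -- A dominating function independent of `n`: the Leibniz rule for second derivatives, with the `3`
  -- of `norm_laplacian_le`.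
  let B : E3 → ℝ := fun x => 3 * (C 0 * ‖φ2 x‖ + 2 * C 1 * ‖φ1 x‖ + C 2 * ‖φ x‖) +
    ‖lam ^ 2‖ * (C 0 * ‖φ x‖)
  have hB : MemLp B 2 volume := by
    have m0 := (φ.memLp 2).norm
    have m1 := (φ1.memLp 2).norm
    have m2 := (φ2.memLp 2).norm
    exact ((((m2.const_mul _).add (m1.const_mul _)).add (m0.const_mul _)).const_mul _).add
      ((m0.const_mul _).const_mul _)
  have hle (n : ℕ) (x : E3) : ‖-(Δ (ψ n)) x - lam ^ 2 * ψ n x‖ ≤ B x := by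
    refine (norm_sub_le _ _).trans (add_le_add ?_ ?_)
    · rw [norm_neg]
      refine (norm_laplacian_le _ _).trans ?_
      gcongr
      refine (norm_iteratedFDeriv_mul_le (hsm n) (φ.smooth ⊤) x (n := 2)
        (by norm_cast)).trans ?_
      have e1 : ‖iteratedFDeriv ℝ 1 φ x‖ = ‖φ1 x‖ := norm_iteratedFDeriv_one _
      have e2 : ‖iteratedFDeriv ℝ 2 φ x‖ = ‖φ2 x‖ := by
        rw [← norm_iteratedFDeriv_fderiv, norm_iteratedFDeriv_one]
        rfl
      simp only [Finset.sum_range_succ, Finset.sum_range_zero, zero_add, Nat.choose_zero_right,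
        Nat.cast_one, one_mul, Nat.sub_zero, Nat.choose_one_right, Nat.choose_self,
        norm_iteratedFDeriv_zero (f := (φ : E3 → ℂ)), Nat.cast_ofNat, Nat.add_one_sub_one, e1, e2]
      gcongr <;> exact hC _ _ _
    · rw [norm_mul, norm_mul]
      gcongr
      simpa using hC 0 n x
  -- Once `c n (‖x‖ + 1) < 1` the cut-off is `1` on the unit ball about `x`, so there is equality
  -- and not only convergence.
  have hlim (x : E3) : ∀ᶠ n in atTop, -(Δ (ψ n)) x - lam ^ 2 * ψ n x = helmholtz lam φ x := by
    have ht : Tendsto (fun n => c n * (‖x‖ + 1)) atTop (𝓝 0) := by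
      simpa [c] using (tendsto_one_div_add_atTop_nhds_zero_nat (𝕜 := ℝ)).mul_const (‖x‖ + 1)
    filter_upwards [ht.eventually_lt_const one_pos] with n hn
    have hev : ψ n =ᶠ[𝓝 x] φ := by
      filter_upwards [Metric.ball_mem_nhds x one_pos] with y hy
      have hy' : ‖c n • y‖ ≤ 1 := by
        rw [norm_smul, Real.norm_of_nonneg (hc0 n).le]
        refine le_trans ?_ hn.le
        have := norm_sub_norm_le y x
        rw [mem_ball_iff_norm] at hy
        gcongr
        linarith
      have : b (c n • y) = 1 := b.one_of_mem_closedBall (by simpa using hy')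
      simp [ψ, χ, this]
    rw [helmholtz_apply, (InnerProductSpace.laplacian_congr_nhds hev).eq_of_nhds, hev.eq_of_nhds]
  have hmeas (n : ℕ) : Continuous fun x => -(Δ (ψ n)) x - lam ^ 2 * ψ n x := by
    have := (helmholtz lam ((hψ n).2.toSchwartzMap (hψ n).1)).continuous
    refine this.congr fun x => ?_
    rw [helmholtz_apply]; rfl
  have hv : MemLp (fun x => ‖v x‖) 2 volume := (Lp.memLp v).norm
  have hT := tendsto_integral_of_dominated_convergence (μ := volume)
    (F := fun n x => v x * (-(Δ (ψ n)) x - lam ^ 2 * ψ n x)) (f := fun x => v x * helmholtz lam φ x)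
    (fun x => ‖v x‖ * B x)
    (fun n => (Lp.aestronglyMeasurable v).mul (hmeas n).aestronglyMeasurable)
    (hv.integrable_mul hB)
    (fun n => ae_of_all _ fun x => by
      rw [norm_mul]; gcongr; exact hle n x)
    (ae_of_all _ fun x => tendsto_const_nhds.congr' (by
      filter_upwards [hlim x] with n hn; rw [hn]))
  simp only [h _ (hψ _)] at hT
  exact (tendsto_nhds_unique hT tendsto_const_nhds)

end Scattering
end

/-! ### Inversion of `I + V R₀(λ)` and the scattering resolvent. -/

noncomputable section

namespace Scattering

open FourierTransform LineDeriv Set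
open scoped SchwartzMap

/-- `f` vanishes almost everywhere outside the ball of radius `r`. -/
def SuppIn (r : ℝ) (f : E3 → ℂ) : Prop := ∀ᵐ x : E3, r < ‖x‖ → f x = 0

lemma SuppIn.mono {r s : ℝ} {f : E3 → ℂ} (h : SuppIn r f) (hrs : r ≤ s) : SuppIn s f := by
  filter_upwards [h] with x hx hxs using hx (hrs.trans_lt hxs)

lemma SuppIn.congr {r : ℝ} {f g : E3 → ℂ} (h : SuppIn r f) (hfg : f =ᵐ[volume] g) :
    SuppIn r g := by
  filter_upwards [h, hfg] with x hx hxe hr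
  rw [← hxe, hx hr]

lemma SuppIn.sub {r : ℝ} {f g : L2} (hf : SuppIn r f) (hg : SuppIn r g) :
    SuppIn r (f - g : L2) := by
  filter_upwards [hf, hg, Lp.coeFn_sub f g] with x h1 h2 h3 hr
  rw [h3, Pi.sub_apply, h1 hr, h2 hr, sub_zero]

lemma SuppIn.neg {r : ℝ} {f : L2} (hf : SuppIn r f) : SuppIn r (-f : L2) := by
  filter_upwards [hf, Lp.coeFn_neg f] with x h1 h3 hr
  rw [h3, Pi.neg_apply, h1 hr, neg_zero]

lemma SuppIn.isL2Comp {r : ℝ} {f : L2} (hf : SuppIn r f) : IsL2Comp f := ⟨Lp.memLp f, r, hf⟩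

lemma freeResolvent_congr {lam : ℂ} {f g : E3 → ℂ} (h : f =ᵐ[volume] g) :
    freeResolvent lam f = freeResolvent lam g := by
  funext x
  refine integral_congr_ae ?_
  filter_upwards [h] with y hy
  rw [hy]

/-- The truncation is invisible: `‖x - y‖ ≤ ρ + r ≤ T` for all points that contribute. -/
lemma truncOp_ae_eq_freeResolvent {g : L2} {r ρ T : ℝ} (hg : SuppIn r g) (hT : 0 ≤ T)
    (hrT : r + ρ ≤ T) (lam : ℂ) :
    ∀ᵐ x : E3, ‖x‖ ≤ ρ → truncOp T lam g x = freeResolvent lam g x := by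
  have h := fourierMult_ae_eq_convolution (integrable_truncKernel T lam)
    (m := bddClass (symb T lam)) (by
      rw [fourier_truncKernel hT]; exact coeFn_bddClass (memLp_symb hT lam)) hg.isL2Comp
  rw [Lp.toLp_coeFn] at h
  filter_upwards [h] with x hx hxρ
  refine hx.trans (integral_congr_ae ?_)
  filter_upwards [hg] with y hy
  by_cases hr : r < ‖y‖
  · simp [hy hr]
  · have hn : ‖x - y‖ ≤ T := (norm_sub_le x y).trans (by linarith)
    rw [truncKernel, indicator_of_mem (mem_Iic.mpr hn), freeKernel_eq]

lemma freeOp_ae_eq_freeResolvent {g : L2} {r : ℝ} (hg : SuppIn r g) {lam : ℂ} (hl : 0 < lam.im) :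
    freeOp lam g =ᵐ[volume] freeResolvent lam g := by
  have h := fourierMult_ae_eq_convolution (integrable_freeProfile_norm hl)
    (m := bddClass (fullSymb lam)) (by
      rw [fourier_freeProfile hl]; exact coeFn_bddClass (memLp_fullSymb hl)) hg.isL2Comp
  rwa [Lp.toLp_coeFn] at h

/-- Multiplication of `L²` functions by a bounded function. -/
def mulOp (m : E3 → ℂ) : L2 →L[ℂ] L2 := mulL (bddClass m)

lemma coeFn_mulOp {m : E3 → ℂ} (hm : MemLp m ∞ volume) (f : L2) :
    mulOp m f =ᵐ[volume] fun x => m x * f x := by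
  filter_upwards [coeFn_mulL (bddClass m) f, coeFn_bddClass hm] with x h1 h2
  rw [mulOp, h1, h2]

lemma norm_mulOp_le {m : E3 → ℂ} {C : ℝ} (hC : 0 ≤ C) (hm : ∀ x, ‖m x‖ ≤ C) : ‖mulOp m‖ ≤ C :=
  (norm_mulL_le _).trans (norm_bddClass_le hC hm)

lemma suppIn_mulOp {m : E3 → ℂ} (hm : MemLp m ∞ volume) {r : ℝ} (hr : ∀ x, r < ‖x‖ → m x = 0)
    (f : L2) : SuppIn r (mulOp m f) := by
  filter_upwards [coeFn_mulOp hm f] with x hx hxr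
  rw [hx, hr x hxr, zero_mul]

/-- The operator `V R₀(λ)` on functions supported in the ball of radius `R₀`. -/
def potOp (V : E3 → ℂ) (R₀ : ℝ) (lam : ℂ) : L2 →L[ℂ] L2 := mulOp V ∘L truncOp (2 * R₀) lam

section
variable {V : E3 → ℂ} {R₀ : ℝ} {lam : ℂ}

lemma mulOp_truncOp_ae_eq (hV : MemLp V ∞ volume) (hV0 : ∀ x, R₀ < ‖x‖ → V x = 0)
    {g : L2} {r T : ℝ} (hg : SuppIn r g) (hT : 0 ≤ T) (hrT : r + R₀ ≤ T) :
    mulOp V (truncOp T lam g) =ᵐ[volume] fun x => V x * freeResolvent lam g x := by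
  filter_upwards [coeFn_mulOp hV (truncOp T lam g), truncOp_ae_eq_freeResolvent hg hT hrT lam]
    with x h1 h2
  rw [h1]
  by_cases h : R₀ < ‖x‖
  · simp [hV0 x h]
  · rw [h2 (not_lt.mp h)]

lemma mulOp_truncOp_eq_potOp (hR₀ : 0 ≤ R₀) (hV : MemLp V ∞ volume)
    (hV0 : ∀ x, R₀ < ‖x‖ → V x = 0) {g : L2} {T : ℝ} (hg : SuppIn R₀ g) (hT : 2 * R₀ ≤ T) :
    mulOp V (truncOp T lam g) = potOp V R₀ lam g := by
  have h1 := mulOp_truncOp_ae_eq (lam := lam) hV hV0 hg (T := T) (by linarith) (by linarith)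
  have h2 := mulOp_truncOp_ae_eq (lam := lam) hV hV0 hg (T := 2 * R₀) (by linarith)
    (by linarith)
  exact Lp.ext (h1.trans h2.symm)

lemma solvesIVR_iff (hR₀ : 0 ≤ R₀) (hV : MemLp V ∞ volume) (hV0 : ∀ x, R₀ < ‖x‖ → V x = 0)
    {f : E3 → ℂ} (hf : MemLp f 2 volume) {g : L2} {r : ℝ} (hr : R₀ ≤ r) (hg : SuppIn r g) :
    SolvesIVR V lam f g ↔ g + mulOp V (truncOp (R₀ + r) lam g) = hf.toLp f := by
  have h1 := mulOp_truncOp_ae_eq (lam := lam) hV hV0 hg (T := R₀ + r) (by linarith)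
    (by linarith)
  constructor
  · rintro ⟨_, h⟩
    refine Lp.ext ?_
    filter_upwards [h, h1, Lp.coeFn_add g (mulOp V (truncOp (R₀ + r) lam g)), hf.coeFn_toLp]
      with x e1 e2 e3 e4
    rw [e3, Pi.add_apply, e2, e1, e4]
  · intro h
    refine ⟨hg.isL2Comp, ?_⟩
    filter_upwards [h1, Lp.coeFn_add g (mulOp V (truncOp (R₀ + r) lam g)), hf.coeFn_toLp]
      with x e2 e3 e4
    rw [h, e4, Pi.add_apply, e2] at e3
    exact e3.symm

lemma eq_zero_of_add_potOp_eq_zero (hu : IsUnit (1 + potOp V R₀ lam)) {d : L2}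
    (h : d + potOp V R₀ lam d = 0) : d = 0 := by
  have : Ring.inverse (1 + potOp V R₀ lam) ((1 + potOp V R₀ lam) d) = d := by
    rw [← mul_apply_eq_comp, Ring.inverse_mul_cancel _ hu]; rfl
  rw [← this]
  have h' : (1 + potOp V R₀ lam) d = 0 := h
  rw [h', map_zero]

/-- The correction `h = V R₀(λ) g`, where `g` solves `(I + V R₀(λ)) g = f`. -/
def corrOp (V : E3 → ℂ) (R₀ r : ℝ) (lam : ℂ) : L2 →L[ℂ] L2 :=
  Ring.inverse (1 + potOp V R₀ lam) ∘L mulOp V ∘L truncOp (R₀ + r) lam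

lemma corrOp_add_potOp (hu : IsUnit (1 + potOp V R₀ lam)) (r : ℝ) (F : L2) :
    corrOp V R₀ r lam F + potOp V R₀ lam (corrOp V R₀ r lam F) =
      mulOp V (truncOp (R₀ + r) lam F) := by
  change (1 + potOp V R₀ lam) (Ring.inverse (1 + potOp V R₀ lam)
    (mulOp V (truncOp (R₀ + r) lam F))) = _
  rw [← mul_apply_eq_comp, Ring.mul_inverse_cancel _ hu]; rfl

lemma suppIn_corrOp (hV : MemLp V ∞ volume) (hV0 : ∀ x, R₀ < ‖x‖ → V x = 0)
    (hu : IsUnit (1 + potOp V R₀ lam)) (r : ℝ) (F : L2) : SuppIn R₀ (corrOp V R₀ r lam F) := by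
  rw [eq_sub_of_add_eq (corrOp_add_potOp hu r F)]
  exact (suppIn_mulOp hV hV0 _).sub (suppIn_mulOp hV hV0 _)

/-- With `g = f - h` the equation becomes `h + V R₀(λ) h = V R₀(λ) f`, whose right side lives where
`V` does. Hence invertibility with the fixed truncation `2R₀` solves the equation for data of any
support radius. -/
lemma solvesIVR_sub_corrOp (hR₀ : 0 ≤ R₀) (hV : MemLp V ∞ volume)
    (hV0 : ∀ x, R₀ < ‖x‖ → V x = 0) (hu : IsUnit (1 + potOp V R₀ lam)) {f : E3 → ℂ}
    (hf : MemLp f 2 volume) {r : ℝ} (hr : R₀ ≤ r) (hfr : SuppIn r f) :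
    SolvesIVR V lam f (hf.toLp f - corrOp V R₀ r lam (hf.toLp f) : L2) := by
  have hF : SuppIn r (hf.toLp f) := hfr.congr hf.coeFn_toLp.symm
  have hh := suppIn_corrOp hV hV0 hu r (hf.toLp f)
  rw [solvesIVR_iff hR₀ hV hV0 hf hr (hF.sub (hh.mono hr)), map_sub, map_sub,
    mulOp_truncOp_eq_potOp hR₀ hV hV0 hh (by linarith), ← corrOp_add_potOp hu r (hf.toLp f)]
  abel

/-- The difference `d` of two solutions satisfies `d = -V R₀(λ) d`, so it is supported in the ball
of radius `R₀`, where invertibility forces `d = 0`. -/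
lemma solvesIVR_unique (hR₀ : 0 ≤ R₀) (hV : MemLp V ∞ volume)
    (hV0 : ∀ x, R₀ < ‖x‖ → V x = 0) (hu : IsUnit (1 + potOp V R₀ lam)) {f g g' : E3 → ℂ}
    (hf : MemLp f 2 volume) (hg : SolvesIVR V lam f g) (hg' : SolvesIVR V lam f g') :
    g' =ᵐ[volume] g := by
  have key : ∀ {g : E3 → ℂ} (hg : SolvesIVR V lam f g), ∃ r₀ : ℝ, ∀ r, r₀ ≤ r → R₀ ≤ r →
      SuppIn r (hg.1.1.toLp g) ∧
      hg.1.1.toLp g + mulOp V (truncOp (R₀ + r) lam (hg.1.1.toLp g)) = hf.toLp f := by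
    intro g hg
    obtain ⟨hg2, r₀, hr₀⟩ := hg.1
    refine ⟨r₀, fun r h1 h2 => ?_⟩
    have hs : SuppIn r (hg2.toLp g) :=
      (SuppIn.congr (r := r₀) hr₀ hg2.coeFn_toLp.symm).mono h1
    refine ⟨hs, (solvesIVR_iff hR₀ hV hV0 hf h2 hs).mp ⟨hs.isL2Comp, ?_⟩⟩
    filter_upwards [hg.2, hg2.coeFn_toLp] with x e1 e2
    rw [freeResolvent_congr hg2.coeFn_toLp, e2, e1]
  obtain ⟨r₁, h₁⟩ := key hg
  obtain ⟨r₂, h₂⟩ := key hg'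
  obtain ⟨s1, e1⟩ := h₁ (max R₀ (max r₁ r₂)) (by simp) (le_max_left _ _)
  obtain ⟨s2, e2⟩ := h₂ (max R₀ (max r₁ r₂)) (by simp) (le_max_left _ _)
  set r := max R₀ (max r₁ r₂)
  have hr : R₀ ≤ r := le_max_left _ _
  set d : L2 := hg'.1.1.toLp g' - hg.1.1.toLp g with hd
  have hd0 : d + mulOp V (truncOp (R₀ + r) lam d) = 0 := by
    rw [hd, map_sub, map_sub, ← sub_eq_zero.mpr (e2.trans e1.symm)]
    abel
  have hds : SuppIn R₀ d := by
    rw [eq_neg_of_add_eq_zero_left hd0]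
    exact (suppIn_mulOp hV hV0 _).neg
  rw [mulOp_truncOp_eq_potOp hR₀ hV hV0 hds (by linarith)] at hd0
  have := sub_eq_zero.mp (eq_zero_of_add_potOp_eq_zero hu hd0)
  exact (MemLp.toLp_eq_toLp_iff _ _).mp this

lemma ivrInvertible_of_isUnit (hR₀ : 0 ≤ R₀) (hV : MemLp V ∞ volume)
    (hV0 : ∀ x, R₀ < ‖x‖ → V x = 0) (hu : IsUnit (1 + potOp V R₀ lam)) : IVRInvertible V lam := by
  rintro f ⟨hf, r, hfr⟩
  have h := solvesIVR_sub_corrOp hR₀ hV hV0 hu hf (le_max_left R₀ r)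
    (SuppIn.mono (r := r) hfr (le_max_right _ _))
  exact ⟨_, h, fun g' hg' => solvesIVR_unique hR₀ hV hV0 hu hf h hg'⟩

lemma scatteringResolvent_eq (hR₀ : 0 ≤ R₀) (hV : MemLp V ∞ volume)
    (hV0 : ∀ x, R₀ < ‖x‖ → V x = 0) (hu : IsUnit (1 + potOp V R₀ lam)) {f : E3 → ℂ}
    (hf : MemLp f 2 volume) {g : E3 → ℂ} (hg : SolvesIVR V lam f g) :
    scatteringResolvent V lam f = freeResolvent lam g := by
  have hex : ∃ g, SolvesIVR V lam f g := ⟨g, hg⟩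
  refine freeResolvent_congr ?_
  rw [ivrInverse, dif_pos hex]
  exact solvesIVR_unique hR₀ hV hV0 hu hf hg hex.choose_spec

/-- The scattering resolvent on functions supported in the ball of radius `R₁`, as an operator
whose values coincide with it on that ball. -/
def resOp (V : E3 → ℂ) (R₀ R₁ : ℝ) (lam : ℂ) : L2 →L[ℂ] L2 :=
  truncOp (2 * R₁) lam - truncOp (R₀ + R₁) lam ∘L corrOp V R₀ R₁ lam

/-- The operator `χ R_V(λ) χ` on `L²`. -/
def cutoffOp (V χ : E3 → ℂ) (R₀ R₁ : ℝ) (lam : ℂ) : L2 →L[ℂ] L2 :=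
  mulOp χ ∘L resOp V R₀ R₁ lam ∘L mulOp χ

lemma IsTest.memLp_top {χ : E3 → ℂ} (hχ : IsTest χ) : MemLp χ ∞ volume :=
  hχ.1.continuous.memLp_top_of_hasCompactSupport hχ.2 volume

lemma cutoffOp_ae_eq (hR₀ : 0 ≤ R₀) (hV : MemLp V ∞ volume) (hV0 : ∀ x, R₀ < ‖x‖ → V x = 0)
    (hu : IsUnit (1 + potOp V R₀ lam)) {χ : E3 → ℂ} (hχ : MemLp χ ∞ volume) {R₁ : ℝ} (hR : R₀ ≤ R₁)
    (hχ0 : ∀ x, R₁ < ‖x‖ → χ x = 0) {f : E3 → ℂ} (hf : MemLp f 2 volume) :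
    cutoffOp V χ R₀ R₁ lam (hf.toLp f) =ᵐ[volume] cutoffResolvent V χ lam f := by
  have hm : MemLp (fun y => χ y * f y) 2 volume := hf.mul hχ
  have hs : SuppIn R₁ fun y => χ y * f y := ae_of_all _ fun x hx => by
    simp only; rw [hχ0 x hx, zero_mul]
  set F : L2 := hm.toLp _ with hF
  have hFe : mulOp χ (hf.toLp f) = F := by
    refine Lp.ext ?_
    filter_upwards [coeFn_mulOp hχ (hf.toLp f), hf.coeFn_toLp, hm.coeFn_toLp] with x h1 h2 h3
    rw [h1, h2, hF, h3]
  have hFs : SuppIn R₁ F := hs.congr hm.coeFn_toLp.symm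
  have hsol := solvesIVR_sub_corrOp hR₀ hV hV0 hu hm hR hs
  have hr := scatteringResolvent_eq hR₀ hV hV0 hu hm hsol
  rw [← hF] at hr
  set h := corrOp V R₀ R₁ lam F with hh
  have hhs : SuppIn R₀ h := suppIn_corrOp hV hV0 hu R₁ F
  -- On `h`, supported in the smaller ball, the truncation `2R₁` is exchanged for `R₀ + R₁`. The
  -- smaller radius is needed for the exponent `2R₁` in the final bound.
  have e0 := truncOp_ae_eq_freeResolvent (hFs.sub (hhs.mono hR)) (ρ := R₁) (T := 2 * R₁)
    (by linarith) (by linarith) lam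
  have e1 := truncOp_ae_eq_freeResolvent hhs (ρ := R₁) (T := 2 * R₁)
    (by linarith) (by linarith) lam
  have e2 := truncOp_ae_eq_freeResolvent hhs (ρ := R₁) (T := R₀ + R₁)
    (by linarith) le_rfl lam
  rw [map_sub] at e0
  have hc : cutoffOp V χ R₀ R₁ lam (hf.toLp f) =
      mulOp χ (truncOp (2 * R₁) lam F - truncOp (R₀ + R₁) lam h) := by
    rw [← hFe] at hh ⊢
    rw [hh]; rfl
  rw [hc]
  filter_upwards [e0, e1, e2, coeFn_mulOp hχ (truncOp (2 * R₁) lam F - truncOp (R₀ + R₁) lam h),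
    Lp.coeFn_sub (truncOp (2 * R₁) lam F) (truncOp (2 * R₁) lam h),
    Lp.coeFn_sub (truncOp (2 * R₁) lam F) (truncOp (R₀ + R₁) lam h)] with x a0 a1 a2 a3 a4 a5
  rw [a3, cutoffResolvent, hr]
  by_cases hx : R₁ < ‖x‖
  · simp [hχ0 x hx]
  · have hx' := not_lt.mp hx
    rw [← a0 hx', a4, a5, Pi.sub_apply, Pi.sub_apply, a1 hx', a2 hx']

lemma differentiable_potOp (hR₀ : 0 ≤ R₀) : Differentiable ℂ (potOp V R₀) := fun lam =>
  (differentiableAt_const _).clm_comp (differentiable_truncOp (by linarith) lam)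

lemma analyticAt_cutoffOp (hR₀ : 0 ≤ R₀) {R₁ : ℝ} (hR : R₀ ≤ R₁) (χ : E3 → ℂ)
    (hu : IsUnit (1 + potOp V R₀ lam)) : AnalyticAt ℂ (cutoffOp V χ R₀ R₁) lam := by
  have hd : Differentiable ℂ fun lam => 1 + potOp V R₀ lam :=
    (differentiable_const _).add (differentiable_potOp hR₀)
  -- Units form an open set, and complex differentiability on an open set gives analyticity.
  have hO : IsOpen {lam | IsUnit (1 + potOp V R₀ lam)} := Units.isOpen.preimage hd.continuous
  refine DifferentiableOn.analyticAt (s := {lam | IsUnit (1 + potOp V R₀ lam)}) ?_ (hO.mem_nhds hu)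
  intro z hz
  refine DifferentiableAt.differentiableWithinAt ?_
  have hi : DifferentiableAt ℂ (fun lam => Ring.inverse (1 + potOp V R₀ lam)) z :=
    DifferentiableAt.fun_comp' z (differentiableAt_inverse (𝕜 := ℂ) hz) (hd z)
  have ht : DifferentiableAt ℂ (truncOp (R₀ + R₁)) z := differentiable_truncOp (by linarith) z
  have ht' : DifferentiableAt ℂ (truncOp (2 * R₁)) z := differentiable_truncOp (by linarith) z
  have hcorr : DifferentiableAt ℂ (corrOp V R₀ R₁) z :=
    hi.clm_comp ((differentiableAt_const _).clm_comp ht)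
  exact (differentiableAt_const _).clm_comp
    ((ht'.sub (ht.clm_comp hcorr)).clm_comp (differentiableAt_const _))

lemma isHolomorphicAcross_of_isUnit (hR₀ : 0 ≤ R₀) (hV : MemLp V ∞ volume)
    (hV0 : ∀ x, R₀ < ‖x‖ → V x = 0) (hu : IsUnit (1 + potOp V R₀ lam)) :
    IsHolomorphicAcross V lam := by
  have hev : ∀ᶠ z in 𝓝[≠] lam, IsUnit (1 + potOp V R₀ z) := by
    have hd : Differentiable ℂ fun lam => 1 + potOp V R₀ lam :=
      (differentiable_const _).add (differentiable_potOp hR₀)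
    exact Filter.Eventually.filter_mono nhdsWithin_le_nhds
      ((Units.isOpen.preimage hd.continuous).mem_nhds hu)
  refine ⟨hev.mono fun z hz => ivrInvertible_of_isUnit hR₀ hV hV0 hz, fun χ hχ => ?_⟩
  obtain ⟨r, hr⟩ := hχ.2.isCompact.isBounded.subset_closedBall (0 : E3)
  have hχ0 : ∀ x, max R₀ r < ‖x‖ → χ x = 0 := fun x hx => by
    refine image_eq_zero_of_notMem_tsupport fun hmem => ?_
    have := mem_closedBall_zero_iff.mp (hr hmem)
    exact absurd hx (not_lt.mpr (this.trans (le_max_right _ _)))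
  refine ⟨cutoffOp V χ R₀ (max R₀ r), analyticAt_cutoffOp hR₀ (le_max_left _ _) χ hu, ?_⟩
  filter_upwards [hev] with z hz f
  have := cutoffOp_ae_eq hR₀ hV hV0 hz hχ.memLp_top (le_max_left R₀ r) hχ0 (Lp.memLp f)
  rwa [Lp.toLp_coeFn] at this

/-- A test function as a Schwartz function. -/
def IsTest.toSchwartz {φ : E3 → ℂ} (hφ : IsTest φ) : 𝓢(E3, ℂ) :=
  HasCompactSupport.toSchwartzMap (And.right hφ) (And.left hφ)

@[simp]
lemma IsTest.coe_toSchwartz {φ : E3 → ℂ} (hφ : IsTest φ) : (hφ.toSchwartz : E3 → ℂ) = φ := rfl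

lemma integrable_mul_schwartz (W : L2) (φ : 𝓢(E3, ℂ)) : Integrable fun x => W x * φ x :=
  (Lp.memLp W).integrable_mul (φ.memLp 2)

lemma integral_schrodinger (hV : MemLp V ∞ volume) (W : L2) {φ : E3 → ℂ} (hφ : IsTest φ) :
    ∫ x, (W x * (-(Δ φ) x) + (V x - lam ^ 2) * W x * φ x) =
      (∫ x, W x * helmholtz lam hφ.toSchwartz x) +
      ∫ x, mulOp V W x * hφ.toSchwartz x := by
  rw [← integral_add (integrable_mul_schwartz W _) (integrable_mul_schwartz (mulOp V W) _)]
  refine integral_congr_ae ?_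
  filter_upwards [coeFn_mulOp hV W] with x hx
  rw [hx, helmholtz_apply, hφ.coe_toSchwartz]
  ring

lemma integral_sub_mul (W W' : L2) (φ : 𝓢(E3, ℂ)) :
    ∫ x, (W - W' : L2) x * φ x = (∫ x, W x * φ x) - ∫ x, W' x * φ x := by
  rw [← integral_sub (integrable_mul_schwartz W φ) (integrable_mul_schwartz W' φ)]
  refine integral_congr_ae ?_
  filter_upwards [Lp.coeFn_sub W W'] with x hx
  rw [hx, Pi.sub_apply, sub_mul]

lemma solvesSchrodinger_scatteringResolvent (hR₀ : 0 ≤ R₀) (hV : MemLp V ∞ volume)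
    (hV0 : ∀ x, R₀ < ‖x‖ → V x = 0) (hu : IsUnit (1 + potOp V R₀ lam)) (hl : 0 < lam.im)
    {f : E3 → ℂ} (hf : IsL2Comp f) :
    SolvesSchrodinger V lam f (scatteringResolvent V lam f) ∧
      ∀ w : E3 → ℂ, SolvesSchrodinger V lam f w → w =ᵐ[volume] scatteringResolvent V lam f := by
  obtain ⟨hf2, r, hfr⟩ := hf
  have hrr : R₀ ≤ max R₀ r := le_max_left _ _
  have hs : SuppIn (max R₀ r) f := SuppIn.mono (r := r) hfr (le_max_right _ _)
  have hsol := solvesIVR_sub_corrOp hR₀ hV hV0 hu hf2 hrr hs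
  have hres := scatteringResolvent_eq hR₀ hV hV0 hu hf2 hsol
  have hGs : SuppIn (max R₀ r) (hf2.toLp f - corrOp V R₀ (max R₀ r) lam (hf2.toLp f) : L2) :=
    SuppIn.sub (hs.congr hf2.coeFn_toLp.symm) ((suppIn_corrOp hV hV0 hu _ _).mono hrr)
  set G : L2 := hf2.toLp f - corrOp V R₀ (max R₀ r) lam (hf2.toLp f)
  set U : L2 := freeOp lam G with hU
  have hUe : U =ᵐ[volume] scatteringResolvent V lam f := by
    rw [hres]; exact freeOp_ae_eq_freeResolvent hGs hl
  -- For `Im λ > 0`, `U = R₀(λ) G` is globally in `L²`, and `(-Δ - λ²) U = G = f - V U`.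
  have hG : G + mulOp V U = hf2.toLp f := by
    refine Lp.ext ?_
    filter_upwards [Lp.coeFn_add G (mulOp V U), coeFn_mulOp hV U, hsol.2, hUe, hf2.coeFn_toLp]
      with x e1 e2 e3 e4 e5
    rw [e1, Pi.add_apply, e2, e5, e4, hres, e3]
  have heq : ∀ φ : E3 → ℂ, IsTest φ →
      ∫ x, (U x * (-(Δ φ) x) + (V x - lam ^ 2) * U x * φ x) = ∫ x, f x * φ x := by
    intro φ hφ
    rw [integral_schrodinger hV U hφ, hU, integral_freeOp_mul_helmholtz hl, ← hU,
      ← integral_add (integrable_mul_schwartz G _) (integrable_mul_schwartz (mulOp V U) _)]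
    refine integral_congr_ae ?_
    filter_upwards [Lp.coeFn_add G (mulOp V U), hf2.coeFn_toLp] with x e1 e2
    rw [hG, e2, Pi.add_apply] at e1
    rw [e1, add_mul, hφ.coe_toSchwartz]
  refine ⟨⟨(memLp_congr_ae hUe).mp (Lp.memLp U), fun φ hφ => ?_⟩, fun w hw => ?_⟩
  · rw [← heq φ hφ]
    refine integral_congr_ae ?_
    filter_upwards [hUe] with x hx
    rw [hx]
  · obtain ⟨hw2, hweq⟩ := hw
    set W : L2 := hw2.toLp w with hW
    have hWe : W =ᵐ[volume] w := hw2.coeFn_toLp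
    -- Uniqueness: `(-Δ - λ²)(W - U) = K` gives `W - U = R₀(λ) K`. Multiplying by `V` yields `K + V
    -- R₀(λ) K = 0`, hence `K = 0`.
    set K : L2 := -(mulOp V (W - U)) with hK
    have hKs : SuppIn R₀ K := (suppIn_mulOp hV hV0 _).neg
    have hzero : W - U - freeOp lam K = 0 := by
      refine eq_zero_of_integral_mul_helmholtz hl (integral_mul_helmholtz_of_isTest fun φ hφ => ?_)
      have h1 := heq φ hφ
      have h2 : ∫ x, (W x * (-(Δ φ) x) + (V x - lam ^ 2) * W x * φ x) = ∫ x, f x * φ x := by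
        rw [← hweq φ hφ]
        refine integral_congr_ae ?_
        filter_upwards [hWe] with x hx
        rw [hx]
      rw [integral_schrodinger hV _ hφ] at h1 h2
      have h3 := integral_sub_mul (W - U) (freeOp lam K)
        (helmholtz lam hφ.toSchwartz)
      rw [integral_freeOp_mul_helmholtz hl, integral_sub_mul W U] at h3
      have h4 : ∫ x, K x * hφ.toSchwartz x =
          (∫ x, mulOp V U x * hφ.toSchwartz x) -
          ∫ x, mulOp V W x * hφ.toSchwartz x := by
        rw [← integral_sub_mul, hK, ← map_neg, neg_sub, map_sub]
      rw [h4] at h3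
      simp only [helmholtz_apply, hφ.coe_toSchwartz] at h1 h2 h3
      rw [h3]
      linear_combination h2 - h1
    have hD : W - U = freeOp lam K := sub_eq_zero.mp hzero
    have hK0 : K + potOp V R₀ lam K = 0 := by
      have : mulOp V (freeOp lam K) = potOp V R₀ lam K := by
        refine Lp.ext ?_
        filter_upwards [coeFn_mulOp hV (freeOp lam K), freeOp_ae_eq_freeResolvent hKs hl,
          mulOp_truncOp_ae_eq (lam := lam) hV hV0 hKs (T := 2 * R₀) (by linarith)
            (by linarith)] with x e1 e2 e3
        rw [e1, e2, ← e3]; rfl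
      rw [← this, ← hD, hK]
      simp
    have hKz := eq_zero_of_add_potOp_eq_zero hu hK0
    rw [hKz, map_zero] at hD
    rw [sub_eq_zero] at hD
    exact hWe.symm.trans (hD ▸ hUe)

end

end Scattering
end

/-! ### Norm estimates for the cut-off resolvent. -/

noncomputable section

namespace Scattering

open FourierTransform LineDeriv Set
open scoped SchwartzMap

section
variable {V : E3 → ℂ} {R₀ : ℝ} {lam : ℂ}

lemma norm_potOp_le (hR₀ : 0 ≤ R₀) (hl : lam ≠ 0) :
    ‖potOp V R₀ lam‖ ≤
      ‖mulOp V‖ * (4 * R₀ * (Real.exp (2 * R₀ * max (-lam.im) 0) / ‖lam‖)) := by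
  refine (ContinuousLinearMap.opNorm_comp_le _ _).trans ?_
  gcongr
  refine (norm_truncOp_le (by linarith) hl).trans_eq ?_
  ring

lemma isUnit_one_add_potOp (h : ‖potOp V R₀ lam‖ ≤ 1 / 2) : IsUnit (1 + potOp V R₀ lam) := by
  have : ‖-potOp V R₀ lam‖ < 1 := by rw [norm_neg]; linarith
  simpa using isUnit_one_sub_of_norm_lt_one this

/-- The term `V R₀(λ) h` has norm at most `‖h‖ / 2` and is absorbed in the left side, whence the
factor `2`. -/
lemma norm_corrOp_le (h : ‖potOp V R₀ lam‖ ≤ 1 / 2) (r : ℝ) (F : L2) :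
    ‖corrOp V R₀ r lam F‖ ≤ 2 * ‖mulOp V‖ * ‖truncOp (R₀ + r) lam‖ * ‖F‖ := by
  have h1 := eq_sub_of_add_eq (corrOp_add_potOp (isUnit_one_add_potOp h) r F)
  have h2 : ‖mulOp V (truncOp (R₀ + r) lam F)‖ ≤ ‖mulOp V‖ * ‖truncOp (R₀ + r) lam‖ * ‖F‖ :=
    ((mulOp V).comp (truncOp (R₀ + r) lam)).le_of_opNorm_le
      (ContinuousLinearMap.opNorm_comp_le _ _) F
  have h3 := ContinuousLinearMap.le_of_opNorm_le _ h (corrOp V R₀ r lam F)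
  have h4 : ‖corrOp V R₀ r lam F‖ ≤ ‖mulOp V (truncOp (R₀ + r) lam F)‖ +
      ‖potOp V R₀ lam (corrOp V R₀ r lam F)‖ := by
    conv_lhs => rw [h1]
    exact norm_sub_le _ _
  linarith

/-- The partial derivatives of `resOp`. -/
def gradResOp (V : E3 → ℂ) (R₀ R₁ : ℝ) (k : Fin 3) (lam : ℂ) : L2 →L[ℂ] L2 :=
  gradOp k (2 * R₁) lam - gradOp k (R₀ + R₁) lam ∘L corrOp V R₀ R₁ lam

lemma exp_add_mul (R₀ R₁ I : ℝ) :
    Real.exp ((R₀ + R₁) * I) ^ 2 = Real.exp (2 * R₀ * I) * Real.exp (2 * R₁ * I) := by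
  rw [← Real.exp_nat_mul, ← Real.exp_add]
  congr 1
  push_cast
  ring

/-- The correction contains `truncOp (R₀ + R₁)` twice, so its size is `e^{2(R₀+R₁)(Im λ)₋}/|λ|²`; by
`hq` the factor `e^{2R₀(Im λ)₋}/|λ|` is at most `1`. -/
lemma norm_resOp_le (hR₀ : 0 ≤ R₀) {R₁ : ℝ} (hR : R₀ ≤ R₁) (hl : lam ≠ 0)
    (h : ‖potOp V R₀ lam‖ ≤ 1 / 2) (hq : Real.exp (2 * R₀ * max (-lam.im) 0) ≤ ‖lam‖) (F : L2) :
    ‖resOp V R₀ R₁ lam F‖ ≤ (4 * R₁ + 8 * ‖mulOp V‖ * (R₀ + R₁) ^ 2) *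
      Real.exp (2 * R₁ * max (-lam.im) 0) / ‖lam‖ * ‖F‖ := by
  have hL : 0 < ‖lam‖ := norm_pos_iff.mpr hl
  have hRR : 0 ≤ R₀ + R₁ := by linarith
  set I := max (-lam.im) 0
  have a1 := ContinuousLinearMap.le_of_opNorm_le _
    (norm_truncOp_le (T := 2 * R₁) (by linarith) hl) F
  have b := norm_truncOp_le hRR hl
  set a := 2 * (R₀ + R₁) * Real.exp ((R₀ + R₁) * I) / ‖lam‖ with ha
  have ha0 : 0 ≤ a := by positivity
  have a2 : ‖truncOp (R₀ + R₁) lam (corrOp V R₀ R₁ lam F)‖ ≤ a * (2 * ‖mulOp V‖ * a * ‖F‖) := by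
    refine (ContinuousLinearMap.le_of_opNorm_le _ b _).trans ?_
    gcongr
    refine (norm_corrOp_le h R₁ F).trans ?_
    gcongr
  have hsq : a * a ≤ 4 * (R₀ + R₁) ^ 2 * (Real.exp (2 * R₁ * I) / ‖lam‖) := by
    have e : a * a = 4 * (R₀ + R₁) ^ 2 * (Real.exp (2 * R₁ * I) / ‖lam‖) *
        (Real.exp (2 * R₀ * I) / ‖lam‖) := by
      rw [ha]
      have := exp_add_mul R₀ R₁ I
      field_simp
      rw [this]; ring
    rw [e]
    refine mul_le_of_le_one_right (by positivity) ?_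
    rwa [div_le_one hL]
  calc ‖resOp V R₀ R₁ lam F‖
      ≤ ‖truncOp (2 * R₁) lam F‖ + ‖truncOp (R₀ + R₁) lam (corrOp V R₀ R₁ lam F)‖ :=
        norm_sub_le _ _
    _ ≤ 2 * (2 * R₁) * Real.exp (2 * R₁ * I) / ‖lam‖ * ‖F‖ +
        2 * ‖mulOp V‖ * (a * a) * ‖F‖ := by
        refine add_le_add a1 (a2.trans_eq ?_); ring
    _ ≤ 2 * (2 * R₁) * Real.exp (2 * R₁ * I) / ‖lam‖ * ‖F‖ + 2 * ‖mulOp V‖ *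
        (4 * (R₀ + R₁) ^ 2 * (Real.exp (2 * R₁ * I) / ‖lam‖)) * ‖F‖ := by gcongr
    _ = _ := by ring

/-- As for `norm_resOp_le`, but the outer operator is `gradOp`, without its factor `1/|λ|`. The
`1/|λ|` spent on `e^{2R₀(Im λ)₋}` is the one inside `corrOp`. -/
lemma norm_gradResOp_le (hR₀ : 0 ≤ R₀) {R₁ : ℝ} (hR : R₀ ≤ R₁) (hl : lam ≠ 0)
    (h : ‖potOp V R₀ lam‖ ≤ 1 / 2) (hq : Real.exp (2 * R₀ * max (-lam.im) 0) ≤ ‖lam‖) (k : Fin 3)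
    (F : L2) :
    ‖gradResOp V R₀ R₁ k lam F‖ ≤ (4 * R₁ + 8 * ‖mulOp V‖ * (R₀ + R₁) ^ 2) *
      Real.exp (2 * R₁ * max (-lam.im) 0) * ‖F‖ := by
  have hL : 0 < ‖lam‖ := norm_pos_iff.mpr hl
  have hRR : 0 ≤ R₀ + R₁ := by linarith
  have hR1 : 0 ≤ R₁ := hR₀.trans hR
  set I := max (-lam.im) 0
  have a1 := ContinuousLinearMap.le_of_opNorm_le _
    (norm_gradOp_le k (T := 2 * R₁) (by linarith) lam) F
  have b := norm_gradOp_le k hRR lam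
  have b' := norm_truncOp_le hRR hl
  set a := (R₀ + R₁) * Real.exp ((R₀ + R₁) * I) with ha
  have ha0 : 0 ≤ a := by positivity
  have b'' : ‖truncOp (R₀ + R₁) lam‖ ≤ 2 * a / ‖lam‖ := b'.trans_eq (by rw [ha]; ring)
  have a2 : ‖gradOp k (R₀ + R₁) lam (corrOp V R₀ R₁ lam F)‖ ≤
      a * (2 * ‖mulOp V‖ * (2 * a / ‖lam‖) * ‖F‖) := by
    refine (ContinuousLinearMap.le_of_opNorm_le _ b _).trans ?_
    gcongr
    refine (norm_corrOp_le h R₁ F).trans ?_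
    gcongr
  have hsq : a * (a / ‖lam‖) ≤ (R₀ + R₁) ^ 2 * Real.exp (2 * R₁ * I) := by
    have e : a * (a / ‖lam‖) = (R₀ + R₁) ^ 2 * Real.exp (2 * R₁ * I) *
        (Real.exp (2 * R₀ * I) / ‖lam‖) := by
      rw [ha]
      linear_combination ((R₀ + R₁) ^ 2 / ‖lam‖) * exp_add_mul R₀ R₁ I
    rw [e]
    refine mul_le_of_le_one_right (by positivity) ?_
    rwa [div_le_one hL]
  calc ‖gradResOp V R₀ R₁ k lam F‖
      ≤ ‖gradOp k (2 * R₁) lam F‖ + ‖gradOp k (R₀ + R₁) lam (corrOp V R₀ R₁ lam F)‖ :=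
        norm_sub_le _ _
    _ ≤ 2 * R₁ * Real.exp (2 * R₁ * I) * ‖F‖ + 4 * ‖mulOp V‖ * (a * (a / ‖lam‖)) * ‖F‖ := by
        refine add_le_add a1 (a2.trans_eq ?_); ring
    _ ≤ 4 * R₁ * Real.exp (2 * R₁ * I) * ‖F‖ + 8 * ‖mulOp V‖ *
        ((R₀ + R₁) ^ 2 * Real.exp (2 * R₁ * I)) * ‖F‖ := by
        gcongr <;> norm_num
    _ = _ := by ring

lemma HasWeakPartial.sub {k : Fin 3} {u u' v v' : L2} (h : HasWeakPartial k u v)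
    (h' : HasWeakPartial k u' v') : HasWeakPartial k (u - u' : L2) (v - v' : L2) := by
  intro φ hφ
  have e := integral_sub_mul u u' (∂_{EuclideanSpace.single k (1 : ℝ)} hφ.toSchwartz)
  have e' := integral_sub_mul v v' hφ.toSchwartz
  simp only [SchwartzMap.lineDerivOp_apply_eq_fderiv, hφ.coe_toSchwartz] at e e'
  rw [e, e', h φ hφ, h' φ hφ]
  ring

lemma HasWeakPartial.congr {k : Fin 3} {u u' v : E3 → ℂ} (h : HasWeakPartial k u v)
    (hu : u =ᵐ[volume] u') : HasWeakPartial k u' v := by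
  intro φ hφ
  rw [← h φ hφ]
  refine integral_congr_ae ?_
  filter_upwards [hu] with x hx
  rw [hx]

/-- The partial derivatives of a test function. -/
def testPartial (χ : E3 → ℂ) (k : Fin 3) (x : E3) : ℂ :=
  fderiv ℝ χ x (EuclideanSpace.single k (1 : ℝ))

lemma IsTest.testPartial {χ : E3 → ℂ} (hχ : IsTest χ) (k : Fin 3) :
    IsTest (Scattering.testPartial χ k) := by
  refine ⟨(∂_{EuclideanSpace.single k (1 : ℝ)} hχ.toSchwartz).smooth ⊤, ?_⟩
  exact hχ.2.fderiv_apply ℝ _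

lemma HasWeakPartial.mulOp {k : Fin 3} {u v : L2} (h : HasWeakPartial k u v) {χ : E3 → ℂ}
    (hχ : IsTest χ) :
    HasWeakPartial k (mulOp χ u) (mulOp (testPartial χ k) u + mulOp χ v : L2) := by
  intro φ hφ
  have hprod : IsTest fun x => χ x * φ x := ⟨hχ.1.mul hφ.1, hφ.2.mul_left⟩
  have hp := h _ hprod
  have hd (x : E3) : fderiv ℝ (fun x => χ x * φ x) x (EuclideanSpace.single k (1 : ℝ)) =
      χ x * fderiv ℝ φ x (EuclideanSpace.single k (1 : ℝ)) + testPartial χ k x * φ x := by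
    have d1 : DifferentiableAt ℝ χ x := hχ.1.differentiable (by simp) x
    have d2 : DifferentiableAt ℝ φ x := hφ.1.differentiable (by simp) x
    rw [fderiv_fun_mul d1 d2]
    simp [testPartial, mul_comm]
  let φ' := ∂_{EuclideanSpace.single k (1 : ℝ)} hφ.toSchwartz
  have i1 := integrable_mul_schwartz (Scattering.mulOp χ u) φ'
  have i2 := integrable_mul_schwartz (Scattering.mulOp (testPartial χ k) u) hφ.toSchwartz
  have i3 := integrable_mul_schwartz (Scattering.mulOp χ v) hφ.toSchwartz
  have c1 := coeFn_mulOp hχ.memLp_top u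
  have c2 := coeFn_mulOp (hχ.testPartial k).memLp_top u
  have c3 := coeFn_mulOp hχ.memLp_top v
  have e1 : ∫ x, u x * fderiv ℝ (fun x => χ x * φ x) x (EuclideanSpace.single k (1 : ℝ)) =
      (∫ x, Scattering.mulOp χ u x * φ' x) +
        ∫ x, Scattering.mulOp (testPartial χ k) u x * hφ.toSchwartz x := by
    rw [← integral_add i1 i2]
    refine integral_congr_ae ?_
    filter_upwards [c1, c2] with x a1 a2
    rw [hd, a1, a2, SchwartzMap.lineDerivOp_apply_eq_fderiv, hφ.coe_toSchwartz]
    ring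
  have e2 : ∫ x, v x * (χ x * φ x) = ∫ x, Scattering.mulOp χ v x * hφ.toSchwartz x := by
    refine integral_congr_ae ?_
    filter_upwards [c3] with x a3
    rw [a3, hφ.coe_toSchwartz]
    ring
  have e3 : ∫ x, (Scattering.mulOp (testPartial χ k) u + Scattering.mulOp χ v : L2) x * φ x =
      (∫ x, Scattering.mulOp (testPartial χ k) u x * hφ.toSchwartz x) +
        ∫ x, Scattering.mulOp χ v x * hφ.toSchwartz x := by
    rw [← integral_add i2 i3]
    refine integral_congr_ae ?_
    filter_upwards [Lp.coeFn_add (Scattering.mulOp (testPartial χ k) u) (Scattering.mulOp χ v)]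
      with x a
    rw [a, Pi.add_apply, hφ.coe_toSchwartz, add_mul]
  have e4 : ∫ x, Scattering.mulOp χ u x * fderiv ℝ φ x (EuclideanSpace.single k (1 : ℝ)) =
      ∫ x, Scattering.mulOp χ u x * φ' x := rfl
  rw [e1, e2] at hp
  rw [e3, e4]
  linear_combination hp

lemma hasWeakPartial_resOp (hR₀ : 0 ≤ R₀) {R₁ : ℝ} (hR : R₀ ≤ R₁) (k : Fin 3) (F : L2) :
    HasWeakPartial k (resOp V R₀ R₁ lam F) (gradResOp V R₀ R₁ k lam F) :=
  (hasWeakPartial_truncOp k (by linarith) lam F).sub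
    (hasWeakPartial_truncOp k (by linarith) lam (corrOp V R₀ R₁ lam F))

lemma eLpNorm_coeFn (F : L2) : eLpNorm F 2 volume = ENNReal.ofReal ‖F‖ := by
  rw [Lp.norm_def, ENNReal.ofReal_toReal (Lp.eLpNorm_ne_top F)]

lemma sobolevNorm_zero_coeFn {u : E3 → ℂ} {F : L2} (hu : F =ᵐ[volume] u) :
    sobolevNorm 0 u = ENNReal.ofReal ‖F‖ := by
  have hm : AEStronglyMeasurable u volume := (Lp.aestronglyMeasurable F).congr hu
  rw [sobolevNorm, iInf_pos hm, ← eLpNorm_congr_ae hu, eLpNorm_coeFn]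

/-- The function and its three partial derivatives give four squares, and `√4 = 2`. -/
lemma sobolevNorm_one_le {u : E3 → ℂ} {F : L2} (hu : F =ᵐ[volume] u) {D : Fin 3 → L2}
    (hD : ∀ k, HasWeakPartial k F (D k)) {B : ℝ} (hF : ‖F‖ ≤ B)
    (hDB : ∀ k, ‖D k‖ ≤ B) : sobolevNorm 1 u ≤ ENNReal.ofReal (2 * B) := by
  rw [sobolevNorm]
  refine (iInf₂_le (fun k => (D k : E3 → ℂ)) fun k => (hD k).congr hu).trans ?_
  have h0 : sobolevNorm 0 u ≤ ENNReal.ofReal B := by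
    rw [sobolevNorm_zero_coeFn hu]; exact ENNReal.ofReal_le_ofReal hF
  have hk (k : Fin 3) : sobolevNorm 0 (D k) ≤ ENNReal.ofReal B := by
    rw [sobolevNorm_zero_coeFn (ae_eq_refl _)]; exact ENNReal.ofReal_le_ofReal (hDB k)
  calc (sobolevNorm 0 u ^ 2 + ∑ k, sobolevNorm 0 (D k) ^ 2) ^ (1 / 2 : ℝ)
      ≤ (ENNReal.ofReal B ^ 2 + ∑ _k : Fin 3, ENNReal.ofReal B ^ 2) ^ (1 / 2 : ℝ) := by
        gcongr with k _
        exact hk k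
    _ = (ENNReal.ofReal (2 * B) ^ 2) ^ (1 / 2 : ℝ) := by
        congr 1
        rw [ENNReal.ofReal_mul zero_le_two, mul_pow]
        simp only [Finset.sum_const, Finset.card_univ, Fintype.card_fin, nsmul_eq_mul]
        push_cast
        norm_num
        ring
    _ = ENNReal.ofReal (2 * B) := by
        rw [← ENNReal.rpow_natCast, ← ENNReal.rpow_mul]
        norm_num

lemma exists_bound_test {χ : E3 → ℂ} (hχ : IsTest χ) : ∃ C, 0 ≤ C ∧ (∀ x, ‖χ x‖ ≤ C) ∧
    ∀ k x, ‖testPartial χ k x‖ ≤ C := by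
  obtain ⟨a, ha⟩ := hχ.2.exists_bound_of_continuous hχ.1.continuous
  choose b hb using fun k =>
    (hχ.testPartial k).2.exists_bound_of_continuous (hχ.testPartial k).1.continuous
  have ha0 : 0 ≤ a := (norm_nonneg _).trans (ha 0)
  have hb0 (k : Fin 3) : 0 ≤ b k := (norm_nonneg _).trans (hb k 0)
  refine ⟨a + ∑ k, b k, add_nonneg ha0 (Finset.sum_nonneg fun k _ => hb0 k), fun x => ?_,
    fun k x => ?_⟩
  · exact (ha x).trans (le_add_of_nonneg_right (Finset.sum_nonneg fun k _ => hb0 k))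
  · refine (hb k x).trans ((Finset.single_le_sum (f := b) (fun k _ => hb0 k)
      (Finset.mem_univ k)).trans (le_add_of_nonneg_left ha0))

/-- The bounds for the cut-off resolvent at points where `V R₀(λ)` is small. -/
lemma sobolevNorm_cutoffResolvent_le (hR₀ : 0 ≤ R₀) (hV : MemLp V ∞ volume)
    (hV0 : ∀ x, R₀ < ‖x‖ → V x = 0) {R₁ : ℝ} (hR : R₀ ≤ R₁) {χ : E3 → ℂ} (hχ : IsTest χ)
    (hχ0 : ∀ x, R₁ < ‖x‖ → χ x = 0) :
    ∃ C : ℝ, ∀ j : ℕ, j ≤ 1 → ∀ lam : ℂ, lam ≠ 0 → ‖potOp V R₀ lam‖ ≤ 1 / 2 →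
      Real.exp (2 * R₀ * max (-lam.im) 0) ≤ ‖lam‖ → ∀ f : E3 → ℂ, MemLp f 2 volume →
        sobolevNorm j (cutoffResolvent V χ lam f) ≤
          ENNReal.ofReal (C * (1 + ‖lam‖) ^ ((j : ℤ) - 1) *
            Real.exp (2 * R₁ * max (-lam.im) 0)) * eLpNorm f 2 volume := by
  obtain ⟨c, hc0, hc, hc'⟩ := exists_bound_test hχ
  have hR1 : 0 ≤ R₁ := hR₀.trans hR
  set M := 4 * R₁ + 8 * ‖mulOp V‖ * (R₀ + R₁) ^ 2 with hM
  have hM0 : 0 ≤ M := by positivity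
  -- For `j = 1` the `4` is the `2` of `sobolevNorm_one_le` times the two terms of the product rule.
  -- For `j = 0` it more than covers `1/|λ| ≤ 2/(1 + |λ|)`, valid as `|λ| ≥ 1`.
  refine ⟨4 * (c * (M * c)), fun j hj lam hl hS hq f hf => ?_⟩
  set I := max (-lam.im) 0 with hI
  have hI0 : 0 ≤ I := le_max_right _ _
  have hL1 : 1 ≤ ‖lam‖ := (Real.one_le_exp (by positivity)).trans hq
  have hae := cutoffOp_ae_eq hR₀ hV hV0 (isUnit_one_add_potOp hS) hχ.memLp_top hR hχ0 hf
  set f' : L2 := hf.toLp f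
  have hfn : eLpNorm f 2 volume = ENNReal.ofReal ‖f'‖ := by
    rw [← eLpNorm_congr_ae hf.coeFn_toLp, eLpNorm_coeFn]
  have hχn := norm_mulOp_le hc0 hc
  set F : L2 := mulOp χ f'
  have hF : ‖F‖ ≤ c * ‖f'‖ := ContinuousLinearMap.le_of_opNorm_le _ hχn _
  set E := Real.exp (2 * R₁ * I)
  have hE : 0 < E := Real.exp_pos _
  set w : L2 := resOp V R₀ R₁ lam F
  have hw : ‖w‖ ≤ M * E / ‖lam‖ * (c * ‖f'‖) :=
    (norm_resOp_le hR₀ hR hl hS hq F).trans (by gcongr)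
  have hw' (k : Fin 3) : ‖gradResOp V R₀ R₁ k lam F‖ ≤ M * E * (c * ‖f'‖) :=
    (norm_gradResOp_le hR₀ hR hl hS hq k F).trans (by gcongr)
  have hu : ‖mulOp χ w‖ ≤ c * (M * E / ‖lam‖ * (c * ‖f'‖)) :=
    (ContinuousLinearMap.le_of_opNorm_le _ hχn _).trans (by gcongr)
  have hae' : mulOp χ w =ᵐ[volume] cutoffResolvent V χ lam f := hae
  have hdiv : M * E / ‖lam‖ ≤ M * E := div_le_self (by positivity) hL1
  rw [hfn, ← ENNReal.ofReal_mul (by positivity)]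
  obtain rfl | rfl : j = 0 ∨ j = 1 := by omega
  · rw [sobolevNorm_zero_coeFn hae']
    refine ENNReal.ofReal_le_ofReal (hu.trans ?_)
    have h2 : ‖lam‖⁻¹ ≤ 4 * (1 + ‖lam‖)⁻¹ := by
      rw [← div_eq_mul_inv, inv_eq_one_div, div_le_div_iff₀ (by linarith) (by linarith)]
      linarith
    have e : ((0 : ℕ) : ℤ) - 1 = -1 := by norm_num
    rw [e, zpow_neg_one]
    calc c * (M * E / ‖lam‖ * (c * ‖f'‖)) = c * (M * E * (c * ‖f'‖)) * ‖lam‖⁻¹ := by ring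
      _ ≤ c * (M * E * (c * ‖f'‖)) * (4 * (1 + ‖lam‖)⁻¹) := by gcongr
      _ = _ := by ring
  · have h := sobolevNorm_one_le hae' (B := 2 * (c * (M * E * (c * ‖f'‖))))
      (fun k => (hasWeakPartial_resOp hR₀ hR k F).mulOp hχ) ?_ fun k => ?_
    · refine h.trans (ENNReal.ofReal_le_ofReal (le_of_eq ?_))
      simp only [Nat.cast_one, sub_self, zpow_zero]
      ring
    · refine hu.trans ?_
      have : c * (M * E / ‖lam‖ * (c * ‖f'‖)) ≤ c * (M * E * (c * ‖f'‖)) := by gcongr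
      have h0 : 0 ≤ c * (M * E * (c * ‖f'‖)) := by positivity
      linarith
    · have t1 : ‖mulOp (testPartial χ k) w‖ ≤ c * (M * E * (c * ‖f'‖)) :=
        (ContinuousLinearMap.le_of_opNorm_le _ (norm_mulOp_le hc0 (hc' k)) _).trans
          (by gcongr; exact hw.trans (by gcongr))
      have t2 : ‖mulOp χ (gradResOp V R₀ R₁ k lam F)‖ ≤ c * (M * E * (c * ‖f'‖)) :=
        (ContinuousLinearMap.le_of_opNorm_le _ hχn _).trans (by gcongr; exact hw' k)
      refine (norm_add_le _ _).trans ?_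
      linarith

end

/-- If `Im λ < 0`, the region gives `e^{2R₀|Im λ|} ≤ |Re λ| e^{-2R₀A}`, and `e^{-2R₀A} ≤ ε`. If `Im
λ ≥ 0`, only `|λ| ≥ 1/ε` is needed: either `Im λ ≥ A/2 ≥ 1/ε`, or the region forces `log |Re λ| >
R₀A`, hence `|Re λ| > 1 + R₀A > 1/ε`. -/
lemma exp_le_mul_norm_of_mem_logRegion {R₀ ε A : ℝ} (hR₀ : 0 < R₀) (hε : 0 < ε)
    (hA : 2 / ε ≤ A) (hA' : 1 / ε ≤ R₀ * A) {lam : ℂ} (h : lam ∈ logRegion R₀ A) :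
    Real.exp (2 * R₀ * max (-lam.im) 0) ≤ ε * ‖lam‖ := by
  obtain ⟨hre, him⟩ := h
  have hre0 : 0 < |lam.re| := abs_pos.mpr hre
  have hrl : |lam.re| ≤ ‖lam‖ := Complex.abs_re_le_norm lam
  have hlog : -(2 * R₀) * lam.im < Real.log |lam.re| - 2 * R₀ * A := by
    have := mul_lt_mul_of_pos_left him (by linarith : (0 : ℝ) < 2 * R₀)
    have e : 2 * R₀ * (-(1 / (2 * R₀)) * Real.log |lam.re| + A) =
        -Real.log |lam.re| + 2 * R₀ * A := by field_simp
    rw [e] at this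
    linarith
  have hRA : 0 < R₀ * A := lt_of_lt_of_le (by positivity) hA'
  rcases le_or_gt 0 lam.im with h0 | h0
  · rw [max_eq_right (by linarith), mul_zero, Real.exp_zero, ← div_le_iff₀' hε]
    rcases le_or_gt (A / 2) lam.im with h1 | h1
    · calc 1 / ε = 2 / ε / 2 := by ring
        _ ≤ A / 2 := by gcongr
        _ ≤ |lam.im| := h1.trans (le_abs_self _)
        _ ≤ ‖lam‖ := Complex.abs_im_le_norm lam
    · have h2 : R₀ * A < Real.log |lam.re| := by nlinarith
      have h3 := (Real.lt_log_iff_exp_lt hre0).mp h2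
      have h4 := Real.add_one_le_exp (R₀ * A)
      linarith
  · rw [max_eq_left (by linarith)]
    have h1 : Real.exp (2 * R₀ * -lam.im) ≤ |lam.re| * Real.exp (-(2 * R₀ * A)) := by
      rw [← Real.exp_log hre0, ← Real.exp_add]
      exact Real.exp_le_exp.mpr (by linarith)
    have h2 : Real.exp (-(2 * R₀ * A)) ≤ ε := by
      rw [Real.exp_neg, inv_le_comm₀ (Real.exp_pos _) hε, inv_eq_one_div]
      have h4 := Real.add_one_le_exp (2 * R₀ * A)
      linarith
    calc _ ≤ _ := h1
      _ ≤ ‖lam‖ * ε := by gcongr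
      _ = _ := mul_comm _ _

end Scattering
end

/-! ### Choice of constants and conclusion. -/

theorem theorem4 (R₀ : ℝ) (hR₀ : 0 < R₀) (V : Scattering.E3 → ℂ)
    (hV : MemLp V ∞ (volume : Measure Scattering.E3))
    (hsupp : tsupport V ⊆ Metric.ball 0 R₀) :
    -- `R_V(λ)` is the resolvent `(P_V - λ²)⁻¹` for `Im λ` large
    (∃ c : ℝ, ∀ lam : ℂ, c < lam.im →
      Scattering.IVRInvertible V lam ∧
      ∀ f : Scattering.E3 → ℂ, Scattering.IsL2Comp f →
        Scattering.SolvesSchrodinger V lam f (Scattering.scatteringResolvent V lam f) ∧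
        ∀ w : Scattering.E3 → ℂ, Scattering.SolvesSchrodinger V lam f w →
          w =ᵐ[volume] Scattering.scatteringResolvent V lam f) ∧
    ∃ A : ℝ, 0 < A ∧
      -- there are no resonances in the logarithmic region
      (∀ lam ∈ Scattering.logRegion R₀ A,
        Scattering.IVRInvertible V lam ∧ ¬ Scattering.IsResonance V lam) ∧
      -- bounds for the cut-off resolvent in the logarithmic region
      ∀ R₁ : ℝ, R₀ ≤ R₁ → ∀ χ : Scattering.E3 → ℂ, Scattering.IsTest χ →
        tsupport χ ⊆ Metric.ball 0 R₁ →
        ∃ C : ℝ, ∀ j : ℕ, j ≤ 1 → ∀ lam ∈ Scattering.logRegion R₀ A,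
          ∀ f : Scattering.E3 → ℂ, MemLp f 2 volume →
            Scattering.sobolevNorm j (Scattering.cutoffResolvent V χ lam f) ≤
              ENNReal.ofReal (C * (1 + ‖lam‖) ^ ((j : ℤ) - 1) *
                Real.exp (2 * R₁ * max (-lam.im) 0)) * eLpNorm f 2 volume := by
  open Scattering in
  have hball : ∀ {g : E3 → ℂ} {R : ℝ}, tsupport g ⊆ Metric.ball 0 R → ∀ x, R < ‖x‖ → g x = 0 :=
    fun hg x hx => image_eq_zero_of_notMem_tsupport fun hmem =>
      absurd hx (not_lt.mpr (mem_ball_zero_iff.mp (hg hmem)).le)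
  have hV0 := hball hsupp
  set v := ‖mulOp V‖
  have hv : 0 ≤ v := norm_nonneg _
  -- `ε` bounds `e^{2R₀(Im λ)₋}/|λ|`: the last condition gives `‖potOp V R₀ λ‖ ≤ 1/2` through
  -- `norm_potOp_le`, and `ε ≤ 1` gives the absorption hypothesis of the resolvent bounds.
  obtain ⟨ε, hε0, hε1, hεv⟩ : ∃ ε : ℝ, 0 < ε ∧ ε ≤ 1 ∧ v * (4 * R₀ * ε) ≤ 1 / 2 := by
    refine ⟨min 1 (1 / (8 * R₀ * (v + 1))), by positivity, min_le_left _ _, ?_⟩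
    calc v * (4 * R₀ * min 1 (1 / (8 * R₀ * (v + 1))))
        ≤ v * (4 * R₀ * (1 / (8 * R₀ * (v + 1)))) := by gcongr; exact min_le_right _ _
      _ = 1 / 2 * (v / (v + 1)) := by field_simp; ring
      _ ≤ 1 / 2 := mul_le_of_le_one_right (by norm_num)
          (div_le_one_of_le₀ (by linarith) (by linarith))
  have key : ∀ lam : ℂ, Real.exp (2 * R₀ * max (-lam.im) 0) ≤ ε * ‖lam‖ →
      lam ≠ 0 ∧ ‖potOp V R₀ lam‖ ≤ 1 / 2 ∧ Real.exp (2 * R₀ * max (-lam.im) 0) ≤ ‖lam‖ := by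
    intro lam h
    have hl : lam ≠ 0 := by
      rintro rfl
      simp at h
      linarith
    have hL : 0 < ‖lam‖ := norm_pos_iff.mpr hl
    refine ⟨hl, (norm_potOp_le hR₀.le hl).trans (le_trans ?_ hεv),
      h.trans (mul_le_of_le_one_left hL.le hε1)⟩
    gcongr
    rwa [div_le_iff₀ hL]
  -- For `Im λ > 1/ε` the exponential is `1` and `|λ| ≥ 1/ε`. The two summands of `A` give `A ≥ 2/ε`
  -- and `R₀A ≥ 1/ε`.
  refine ⟨⟨1 / ε, fun lam hlam => ?_⟩, 2 / ε + 1 / (ε * R₀), by positivity, ?_, ?_⟩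
  · have hl : 0 < lam.im := lt_trans (by positivity) hlam
    have hu := isUnit_one_add_potOp (key lam (by
      rw [max_eq_right (by linarith), mul_zero, Real.exp_zero, ← div_le_iff₀' hε0]
      exact hlam.le.trans ((le_abs_self _).trans (Complex.abs_im_le_norm lam)))).2.1
    exact ⟨ivrInvertible_of_isUnit hR₀.le hV hV0 hu,
      fun f hf => solvesSchrodinger_scatteringResolvent hR₀.le hV hV0 hu hl hf⟩
  all_goals
    have hreg : ∀ lam ∈ logRegion R₀ (2 / ε + 1 / (ε * R₀)),
        Real.exp (2 * R₀ * max (-lam.im) 0) ≤ ε * ‖lam‖ := fun lam hlam => by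
      refine exp_le_mul_norm_of_mem_logRegion hR₀ hε0 (le_add_of_nonneg_right (by positivity)) ?_
        hlam
      have e : R₀ * (2 / ε + 1 / (ε * R₀)) = 1 / ε + 2 * R₀ / ε := by field_simp; ring
      rw [e]
      exact le_add_of_nonneg_right (by positivity)
  · intro lam hlam
    have hu := isUnit_one_add_potOp (key lam (hreg lam hlam)).2.1
    exact ⟨ivrInvertible_of_isUnit hR₀.le hV hV0 hu,
      not_not.mpr (isHolomorphicAcross_of_isUnit hR₀.le hV hV0 hu)⟩
  · intro R₁ hR χ hχ hχs
    obtain ⟨C, hC⟩ := sobolevNorm_cutoffResolvent_le hR₀.le hV hV0 hR hχ (hball hχs)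
    refine ⟨C, fun j hj lam hlam f hf => ?_⟩
    obtain ⟨h1, h2, h3⟩ := key lam (hreg lam hlam)
    exact hC j hj lam h1 h2 h3 f hf
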